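/- Let $k$ be a field, $P$ a unital associative $k$-algebra, $C$ a coassociative counital $k$-coalgebra (all unadorned tensor products are over $k$), and let $(P,C,\psi)$ be an entwining structure, i.e. $\psi:C\otimes P\to P\otimes C$ is a $k$-linear map, written $\psi(c\otimes p)=p_\alpha\otimes c^\alpha$, such that for all $c\in C$, $p,p'\in P$ $$\psi(c\otimes pp')=p_\alpha p'_\beta\otimes c^{\alpha\beta},\qquad \psi(c\otimes 1)=1\otimes c,\qquad p_\alpha\otimes\Delta(c^\alpha)=p_{\alpha\beta}\otimes c_{(1)}{}^{\beta}\otimes c_{(2)}{}^{\alpha},\qquad p_\alpha\,\varepsilon(c^\alpha)=\varepsilon(c)\,p .$$ An entwined module is a right $P$-module and right $C$-comodule $M$, with coaction $\varrho^M(m)=m_{(0)}\otimes m_{(1)}$, such that $\varrho^M(m\cdot p)=m_{(0)}\cdot\psi(m_{(1)}\otimes p)$ for all $m\in M$, $p\in P$, where $m\cdot(p\otimes c):=m\cdot p\otimes c$. The category $\mathbf M_P^C(\psi)$ has the entwined modules as objects and the right $P$-linear right $C$-colinear maps as morphisms. Suppose that $P$ carries a right $C$-coaction $\Delta_P$ which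 makes it, with right multiplication, an entwined module. Put $$B:=P^{coC}=\{b\in P\mid \Delta_P(bp)=b\,\Delta_P(p)\ \text{for all } p\in P\},$$ a subalgebra of $P$, and for every entwined module $M$ let $M^{coC}:=\{m\in M\mid \varrho^M(m)=m\cdot\Delta_P(1)\}$, a right $B$-module. Then the following are equivalent: (a) The extension $B\subseteq P$ is coalgebra-Galois, i.e. the canonical map $can:P\otimes_BP\to P\otimes C$, $p\otimes p'\mapsto p\,\Delta_P(p')$, is bijective; $\psi$ is its canonical entwining map, i.e. $\psi(c\otimes p)=can\big(can^{-1}(1\otimes c)\cdot p\big)$ for all $c\in C$, $p\in P$, where $(p'\otimes p'')\cdot p=p'\otimes p''p$; and $P$ is flat as a left $B$-module. (b) The functor $(-)^{coC}$ from $\mathbf M_P^C(\psi)$ to the category of right $B$-modules is fully faithful. (c) For every entwined module $M$, the map $\sigma_M:M^{coC}\otimes_BP\to M$, $m\otimes p\mapsto m\cdot p$ (the counit of the adjunction between $-\otimes_BP$ and $(-)^{coC}$), is an isomorphism. -/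

import Mathlib

open scoped TensorProduct
open MulOpposite (op)
open CategoryTheory

universe v u

noncomputable section

/-! ### Balanced tensor products over a noncommutative algebra

Right modules over a ring `B` are modules over `Bᵐᵒᵖ`. -/

section Balanced

variable (k : Type v) [Field k] (B : Type u) [Ring B] [Algebra k B]

/-- The relations `m b ⊗ n = m ⊗ b n` imposed on `M ⊗[k] N`. -/
def balancedRelations (M N : Type u) [AddCommGroup M] [Module k M] [Module Bᵐᵒᵖ M]
    [AddCommGroup N] [Module k N] [Module B N] : Submodule k (M ⊗[k] N) :=
  Submodule.span k
    {x | ∃ (m : M) (b : B) (n : N), x = (op b • m) ⊗ₜ[k] n - m ⊗ₜ[k] (b • n)}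

/-- The tensor product `M ⊗_B N` of a right `B`-module `M` and a left `B`-module `N`
over the (noncommutative) `k`-algebra `B`, as a `k`-vector space. -/
abbrev BalTensor (M N : Type u) [AddCommGroup M] [Module k M] [Module Bᵐᵒᵖ M]
    [AddCommGroup N] [Module k N] [Module B N] : Type u :=
  (M ⊗[k] N) ⧸ balancedRelations k B M N

namespace BalTensor

variable {M M' N N' : Type u}
  [AddCommGroup M] [Module k M] [Module Bᵐᵒᵖ M] [IsScalarTower k Bᵐᵒᵖ M]
  [AddCommGroup M'] [Module k M'] [Module Bᵐᵒᵖ M'] [IsScalarTower k Bᵐᵒᵖ M']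
  [AddCommGroup N] [Module k N] [Module B N] [IsScalarTower k B N]
  [AddCommGroup N'] [Module k N'] [Module B N'] [IsScalarTower k B N']
  {V : Type u} [AddCommGroup V] [Module k V]

/-- The linear map `M ⊗_B N → V`, `m ⊗ n ↦ f m n`, for a `B`-balanced bilinear map `f`. -/
def lift (f : M →ₗ[k] N →ₗ[k] V) (hf : ∀ (m : M) (b : B) (n : N), f (op b • m) n = f m (b • n)) :
    BalTensor k B M N →ₗ[k] V :=
  (balancedRelations k B M N).liftQ (TensorProduct.lift f) (by
    refine Submodule.span_le.2 ?_
    rintro _ ⟨m, b, n, rfl⟩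
    simp [hf])

/-- The map `f ⊗_B g : M ⊗_B N → M' ⊗_B N'`, for `f` right `B`-linear and `g` left `B`-linear. -/
def map (f : M →ₗ[Bᵐᵒᵖ] M') (g : N →ₗ[B] N') : BalTensor k B M N →ₗ[k] BalTensor k B M' N' :=
  Submodule.mapQ _ _ (TensorProduct.map (f.restrictScalars k) (g.restrictScalars k)) (by
    refine Submodule.span_le.2 ?_
    rintro _ ⟨m, b, n, rfl⟩
    refine Submodule.subset_span ⟨f m, b, g n, ?_⟩
    simp)

end BalTensor

/-- The left `B`-module `N` is flat: `- ⊗_B N` preserves injectivity of right `B`-linear maps.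
(Every module over the `k`-algebra `B` is canonically a compatible `k`-vector space.) -/
def IsLeftFlat (N : Type u) [AddCommGroup N] [Module k N] [Module B N] [IsScalarTower k B N] :
    Prop :=
  ∀ (M M' : Type u) [AddCommGroup M] [Module k M] [Module Bᵐᵒᵖ M] [IsScalarTower k Bᵐᵒᵖ M]
    [AddCommGroup M'] [Module k M'] [Module Bᵐᵒᵖ M'] [IsScalarTower k Bᵐᵒᵖ M']
    (f : M →ₗ[Bᵐᵒᵖ] M'), Function.Injective f →
      Function.Injective (BalTensor.map k B f (LinearMap.id : N →ₗ[B] N))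

end Balanced

/-! ### Comodules, entwining structures and entwined modules -/

/-- A right `C`-comodule structure on the `k`-vector space `M`. -/
class RightComodule (k : Type v) [Field k] (C : Type u) [AddCommGroup C] [Module k C]
    [Coalgebra k C] (M : Type u) [AddCommGroup M] [Module k M] where
  /-- The coaction `M → M ⊗ C`. -/
  coact : M →ₗ[k] M ⊗[k] C
  coassoc : (TensorProduct.assoc k M C C).toLinearMap ∘ₗ coact.rTensor C ∘ₗ coact =
    (Coalgebra.comul (R := k) (A := C)).lTensor M ∘ₗ coact
  counit : (TensorProduct.rid k M).toLinearMap ∘ₗ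
    (Coalgebra.counit (R := k) (A := C)).lTensor M ∘ₗ coact = LinearMap.id

/-- An entwining structure `(P, C, ψ)`: a linear map `ψ : C ⊗ P → P ⊗ C` making the two pentagons
and the two triangles of the bow-tie diagram commute. -/
structure Entwining (k : Type v) [Field k] (P : Type u) [Ring P] [Algebra k P]
    (C : Type u) [AddCommGroup C] [Module k C] [Coalgebra k C] where
  /-- The entwining map. -/
  ψ : C ⊗[k] P →ₗ[k] P ⊗[k] C
  /-- Left pentagon: `ψ ∘ (id ⊗ m) = (m ⊗ id) ∘ (id ⊗ ψ) ∘ (ψ ⊗ id)`. -/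
  mul : ψ ∘ₗ (LinearMap.mul' k P).lTensor C =
    (LinearMap.mul' k P).rTensor C ∘ₗ (TensorProduct.assoc k P P C).symm.toLinearMap ∘ₗ
      ψ.lTensor P ∘ₗ (TensorProduct.assoc k P C P).toLinearMap ∘ₗ ψ.rTensor P ∘ₗ
        (TensorProduct.assoc k C P P).symm.toLinearMap
  /-- Left triangle. -/
  one : ∀ c : C, ψ (c ⊗ₜ[k] 1) = 1 ⊗ₜ[k] c
  /-- Right pentagon: `(id ⊗ Δ) ∘ ψ = (ψ ⊗ id) ∘ (id ⊗ ψ) ∘ (Δ ⊗ id)`. -/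
  comul : (Coalgebra.comul (R := k) (A := C)).lTensor P ∘ₗ ψ =
    (TensorProduct.assoc k P C C).toLinearMap ∘ₗ ψ.rTensor C ∘ₗ
      (TensorProduct.assoc k C P C).symm.toLinearMap ∘ₗ ψ.lTensor C ∘ₗ
        (TensorProduct.assoc k C C P).toLinearMap ∘ₗ
          (Coalgebra.comul (R := k) (A := C)).rTensor P
  /-- Right triangle: `(id ⊗ ε) ∘ ψ = ε ⊗ id`. -/
  counit : (TensorProduct.rid k P).toLinearMap ∘ₗ
      (Coalgebra.counit (R := k) (A := C)).lTensor P ∘ₗ ψ =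
    (TensorProduct.lid k P).toLinearMap ∘ₗ (Coalgebra.counit (R := k) (A := C)).rTensor P

section

variable {k : Type v} [Field k] {P : Type u} [Ring P] [Algebra k P]
  {C : Type u} [AddCommGroup C] [Module k C] [Coalgebra k C]

/-- The action `(m, p) ↦ m p` of a right `P`-module, as a bilinear map. -/
def rightAct (k : Type v) [Field k] (P : Type u) [Ring P] [Algebra k P]
    (M : Type u) [AddCommGroup M] [Module k M] [Module Pᵐᵒᵖ M] [IsScalarTower k Pᵐᵒᵖ M] :
    M →ₗ[k] P →ₗ[k] M :=
  LinearMap.mk₂ k (fun m p => op p • m)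
    (fun _ _ _ => smul_add _ _ _)
    (fun c m p => by
      rw [← algebraMap_smul Pᵐᵒᵖ c m, ← algebraMap_smul Pᵐᵒᵖ c (op p • m), smul_smul, smul_smul,
        Algebra.commutes])
    (fun _ _ _ => by rw [MulOpposite.op_add, add_smul])
    (fun c m p => by rw [MulOpposite.op_smul, smul_assoc])

/-- `m · (p ⊗ c) = m p ⊗ c`, a map `P ⊗ C → M ⊗ C` for every `m` in a right `P`-module `M`. -/
def actTensor (k : Type v) [Field k] (P : Type u) [Ring P] [Algebra k P]
    (C : Type u) [AddCommGroup C] [Module k C]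
    (M : Type u) [AddCommGroup M] [Module k M] [Module Pᵐᵒᵖ M] [IsScalarTower k Pᵐᵒᵖ M] :
    M →ₗ[k] P ⊗[k] C →ₗ[k] M ⊗[k] C :=
  LinearMap.rTensorHom C ∘ₗ rightAct k P M

namespace Entwining

/-- The map `M ⊗ C → M ⊗ C`, `m ⊗ c ↦ m · ψ(c ⊗ p)`. -/
def act (E : Entwining k P C) (M : Type u) [AddCommGroup M] [Module k M] [Module Pᵐᵒᵖ M]
    [IsScalarTower k Pᵐᵒᵖ M] (p : P) : M ⊗[k] C →ₗ[k] M ⊗[k] C :=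
  TensorProduct.lift
    ((actTensor k P C M).compl₂ (E.ψ ∘ₗ (TensorProduct.mk k C P).flip p))

end Entwining

/-- A right `P`-module and right `C`-comodule `M` is an entwined module if
`ρ(m p) = m₀ · ψ(m₁ ⊗ p)`. -/
class IsEntwinedModule (E : Entwining k P C) (M : Type u) [AddCommGroup M] [Module k M]
    [Module Pᵐᵒᵖ M] [IsScalarTower k Pᵐᵒᵖ M] [RightComodule k C M] : Prop where
  coact_smul : ∀ (m : M) (p : P),
    RightComodule.coact (k := k) (C := C) (op p • m) =
      E.act M p (RightComodule.coact (k := k) (C := C) m)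

/-- `m b · x = m · (b x)`. -/
theorem actTensor_op_smul {k : Type v} [Field k] {P : Type u} [Ring P] [Algebra k P]
    {C : Type u} [AddCommGroup C] [Module k C] {M : Type u} [AddCommGroup M] [Module k M] [Module Pᵐᵒᵖ M]
    [IsScalarTower k Pᵐᵒᵖ M] (m : M) (b : P) (x : P ⊗[k] C) :
    actTensor k P C M (op b • m) x = actTensor k P C M m (b • x) := by
  induction x with
  | zero => simp
  | add x y hx hy => rw [smul_add, map_add, map_add, hx, hy]
  | tmul p c =>
    rw [TensorProduct.smul_tmul']
    simp [actTensor, rightAct, smul_smul]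

/-- The right `P`-action `(m ⊗ c, p) ↦ m · ψ(c ⊗ p)` on `M ⊗ C` is natural in `M`. -/
theorem Entwining.act_actTensor (E : Entwining k P C) {M : Type u} [AddCommGroup M] [Module k M]
    [Module Pᵐᵒᵖ M] [IsScalarTower k Pᵐᵒᵖ M] (m : M) (p : P) (x : P ⊗[k] C) :
    E.act M p (actTensor k P C M m x) = actTensor k P C M m (E.act P p x) := by
  induction x with
  | zero => simp
  | add x y hx hy => simp only [map_add, hx, hy]
  | tmul q c =>
    have h1 : actTensor k P C M m (q ⊗ₜ[k] c) = (op q • m) ⊗ₜ[k] c := rfl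
    have h2 : E.act P p (q ⊗ₜ[k] c) = actTensor k P C P q (E.ψ (c ⊗ₜ[k] p)) := rfl
    have h3 : E.act M p ((op q • m) ⊗ₜ[k] c) =
      actTensor k P C M (op q • m) (E.ψ (c ⊗ₜ[k] p)) := rfl
    rw [h1, h2, h3, actTensor_op_smul]
    congr 1

/-! ### Coaction invariants -/

/-- The subalgebra `P^{co C} = {b | Δ_P(b p) = b Δ_P(p) for all p}` of an algebra `P` which is a
right `C`-comodule. -/
def coinvSubalgebra (k : Type v) [Field k] (C : Type u) [AddCommGroup C] [Module k C]
    [Coalgebra k C] (P : Type u) [Ring P] [Algebra k P] [RightComodule k C P] :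
    Subalgebra k P where
  carrier := {b | ∀ p : P, RightComodule.coact (k := k) (C := C) (b * p) =
    b • RightComodule.coact (k := k) (C := C) p}
  mul_mem' := by
    intro a b ha hb p
    rw [mul_assoc, ha, hb, smul_smul]
  add_mem' := by
    intro a b ha hb p
    rw [add_mul, map_add, ha, hb, add_smul]
  algebraMap_mem' := by
    intro r p
    rw [← Algebra.smul_def, map_smul, algebraMap_smul]

variable [RightComodule k C P]

/-- A right `P`-module is a right `B`-module by restriction, `B = P^{co C}`. -/
instance coinvModule (M : Type u) [AddCommGroup M] [Module Pᵐᵒᵖ M] :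
    Module (coinvSubalgebra k C P)ᵐᵒᵖ M :=
  Module.compHom M (RingHom.op (coinvSubalgebra k C P).val.toRingHom)

theorem coinv_op_smul {M : Type u} [AddCommGroup M] [Module Pᵐᵒᵖ M]
    (b : coinvSubalgebra k C P) (m : M) : op b • m = op (b : P) • m := rfl

instance coinvModule_isScalarTower (M : Type u) [AddCommGroup M] [Module k M] [Module Pᵐᵒᵖ M]
    [IsScalarTower k Pᵐᵒᵖ M] : IsScalarTower k (coinvSubalgebra k C P)ᵐᵒᵖ M where
  smul_assoc r b m := by
    obtain ⟨b, rfl⟩ := MulOpposite.op_surjective b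
    change op ((r • b : coinvSubalgebra k C P) : P) • m = r • (op (b : P) • m)
    rw [Subalgebra.coe_smul, MulOpposite.op_smul, smul_assoc]

/-- For `b ∈ P^{co C}`, evaluating the defining identity at `1`. -/
theorem coact_coinv (b : coinvSubalgebra k C P) :
    RightComodule.coact (k := k) (C := C) (b : P) =
      (b : P) • RightComodule.coact (k := k) (C := C) (1 : P) := by
  have h := b.2 1
  rwa [mul_one] at h

/-- The coaction invariants `M^{co C} = {m | ρ(m) = m · Δ_P(1)}` of an entwined module `M`, a right
module over `B = P^{co C}`. -/
def coinvariants (E : Entwining k P C) [IsEntwinedModule E P] (M : Type u) [AddCommGroup M]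
    [Module k M] [Module Pᵐᵒᵖ M] [IsScalarTower k Pᵐᵒᵖ M] [RightComodule k C M]
    [IsEntwinedModule E M] : Submodule (coinvSubalgebra k C P)ᵐᵒᵖ M where
  carrier := {m | RightComodule.coact (k := k) (C := C) m =
    actTensor k P C M m (RightComodule.coact (k := k) (C := C) (1 : P))}
  add_mem' := by
    intro a b ha hb
    simp only [Set.mem_ofPred_eq] at *
    rw [map_add, ha, hb, map_add, LinearMap.add_apply]
  zero_mem' := by simp
  smul_mem' := by
    intro b m hm
    obtain ⟨b, rfl⟩ := MulOpposite.op_surjective b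
    simp only [Set.mem_ofPred_eq] at *
    rw [coinv_op_smul, IsEntwinedModule.coact_smul (E := E), hm, E.act_actTensor,
      ← IsEntwinedModule.coact_smul (E := E), actTensor_op_smul, ← coact_coinv]
    simp

/-- The counit of adjunction `σ_M : M^{co C} ⊗_B P → M`, `m ⊗ p ↦ m p`. -/
def counitMap (E : Entwining k P C) [IsEntwinedModule E P] (M : Type u) [AddCommGroup M]
    [Module k M] [Module Pᵐᵒᵖ M] [IsScalarTower k Pᵐᵒᵖ M] [RightComodule k C M]
    [IsEntwinedModule E M] :
    BalTensor k (coinvSubalgebra k C P) (coinvariants E M) P →ₗ[k] M :=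
  BalTensor.lift k (coinvSubalgebra k C P)
    ((rightAct k P M).domRestrict ((coinvariants E M).restrictScalars k))
    (by
      intro m b p
      change op p • (op (b : P) • (m : M)) = op ((b : P) * p) • (m : M)
      rw [smul_smul, ← MulOpposite.op_mul])

/-! ### Coalgebra-Galois extensions -/

/-- The canonical map `can : P ⊗_B P → P ⊗ C`, `p ⊗ q ↦ p Δ_P(q)`, where `B = P^{co C}`. -/
def canMap (k : Type v) [Field k] (C : Type u) [AddCommGroup C] [Module k C]
    [Coalgebra k C] (P : Type u) [Ring P] [Algebra k P] [RightComodule k C P] :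
    BalTensor k (coinvSubalgebra k C P) P P →ₗ[k] P ⊗[k] C :=
  BalTensor.lift k (coinvSubalgebra k C P)
    (LinearMap.mk₂ k (fun p q => p • RightComodule.coact (k := k) (C := C) q)
      (fun _ _ _ => add_smul _ _ _)
      (fun _ _ _ => smul_assoc _ _ _)
      (fun _ _ _ => by rw [map_add, smul_add])
      (fun _ _ _ => by rw [map_smul, smul_comm]))
    (by
      intro p b q
      change (p * (b : P)) • RightComodule.coact (k := k) (C := C) q =
        p • RightComodule.coact (k := k) (C := C) ((b : P) * q)
      rw [b.2 q, smul_smul])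

/-- `P^{co C} ⊆ P` is a coalgebra-Galois `C`-extension: the canonical map is bijective. -/
def IsCoalgebraGalois (k : Type v) [Field k] (C : Type u) [AddCommGroup C] [Module k C]
    [Coalgebra k C] (P : Type u) [Ring P] [Algebra k P] [RightComodule k C P] : Prop :=
  Function.Bijective (canMap k C P)

/-- The translation map `τ : C → P ⊗_B P`, `c ↦ can⁻¹(1 ⊗ c)`, of a coalgebra-Galois extension. -/
def translationMap (h : IsCoalgebraGalois k C P) :
    C →ₗ[k] BalTensor k (coinvSubalgebra k C P) P P :=
  (LinearEquiv.ofBijective (canMap k C P) h).symm.toLinearMap ∘ₗ TensorProduct.mk k P C 1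

/-- Right multiplication `p ⊗ q ↦ p ⊗ q r` on `P ⊗_B P`. -/
def rightMulBal (k : Type v) [Field k] (C : Type u) [AddCommGroup C] [Module k C]
    [Coalgebra k C] (P : Type u) [Ring P] [Algebra k P] [RightComodule k C P] (r : P) :
    BalTensor k (coinvSubalgebra k C P) P P →ₗ[k] BalTensor k (coinvSubalgebra k C P) P P :=
  BalTensor.map k (coinvSubalgebra k C P)
    (LinearMap.id : P →ₗ[(coinvSubalgebra k C P)ᵐᵒᵖ] P)
    (LinearMap.mulRight (coinvSubalgebra k C P) r)

/-- `ψ : C ⊗ P → P ⊗ C` is the canonical entwining map `c ⊗ p ↦ can(τ(c) p)` of the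
coalgebra-Galois extension `P^{co C} ⊆ P`. -/
def IsCanonicalEntwining (h : IsCoalgebraGalois k C P) (E : Entwining k P C) : Prop :=
  ∀ (c : C) (p : P), E.ψ (c ⊗ₜ[k] p) = canMap k C P (rightMulBal k C P p (translationMap h c))

/-! ### The category of entwined modules and the coaction-invariants functor -/

/-- Objects of the category `M_P^C(ψ)` of entwined modules. -/
structure EntwinedModuleCat (E : Entwining k P C) where
  /-- The underlying type. -/
  carrier : Type u
  [addCommGroup : AddCommGroup carrier]
  [module : Module k carrier]
  [opModule : Module Pᵐᵒᵖ carrier]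
  [isScalarTower : IsScalarTower k Pᵐᵒᵖ carrier]
  [comodule : RightComodule k C carrier]
  [isEntwined : IsEntwinedModule E carrier]

namespace EntwinedModuleCat

attribute [instance] addCommGroup module opModule isScalarTower comodule isEntwined

variable {E : Entwining k P C}

/-- Morphisms of entwined modules: right `P`-linear right `C`-colinear maps. -/
@[ext]
structure Hom (M N : EntwinedModuleCat E) where
  /-- The underlying right `P`-linear map. -/
  toLinearMap : M.carrier →ₗ[Pᵐᵒᵖ] N.carrier
  colinear : ∀ m : M.carrier, RightComodule.coact (k := k) (C := C) (toLinearMap m) =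
    (toLinearMap.restrictScalars k).rTensor C (RightComodule.coact (k := k) (C := C) m)

instance category : Category (EntwinedModuleCat E) where
  Hom M N := Hom M N
  id M := ⟨LinearMap.id, fun m => by
    have : (LinearMap.id : M.carrier →ₗ[Pᵐᵒᵖ] M.carrier).restrictScalars k = LinearMap.id := rfl
    rw [this, LinearMap.rTensor_id]; rfl⟩
  comp f g := ⟨g.toLinearMap ∘ₗ f.toLinearMap, fun m => by
    have : (g.toLinearMap ∘ₗ f.toLinearMap).restrictScalars k =
      g.toLinearMap.restrictScalars k ∘ₗ f.toLinearMap.restrictScalars k := rfl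
    rw [this, LinearMap.rTensor_comp, LinearMap.comp_apply, LinearMap.comp_apply, g.colinear,
      f.colinear]⟩

variable [IsEntwinedModule E P]

/-- The restriction of a morphism to coaction invariants. -/
def Hom.coinv {M N : EntwinedModuleCat E} (f : Hom M N) :
    coinvariants E M.carrier →ₗ[(coinvSubalgebra k C P)ᵐᵒᵖ] coinvariants E N.carrier where
  toFun m := ⟨f.toLinearMap m, by
    have hm : RightComodule.coact (k := k) (C := C) (m : M.carrier) =
      actTensor k P C M.carrier m (RightComodule.coact (k := k) (C := C) (1 : P)) := m.2
    change RightComodule.coact (k := k) (C := C) (f.toLinearMap m) =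
      actTensor k P C N.carrier (f.toLinearMap m) (RightComodule.coact (k := k) (C := C) (1 : P))
    rw [f.colinear, hm]
    induction RightComodule.coact (k := k) (C := C) (1 : P) with
    | zero => simp
    | add x y hx hy => simp only [map_add, hx, hy]
    | tmul p c =>
      change f.toLinearMap (op p • (m : M.carrier)) ⊗ₜ[k] c =
        (op p • f.toLinearMap (m : M.carrier)) ⊗ₜ[k] c
      rw [map_smul]⟩
  map_add' a b := Subtype.ext (map_add f.toLinearMap _ _)
  map_smul' b m := Subtype.ext (by
    obtain ⟨b, rfl⟩ := MulOpposite.op_surjective b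
    exact map_smul f.toLinearMap (op (b : P)) (m : M.carrier))

/-- The coaction-invariants functor `(-)^{co C}` from entwined modules to right `B`-modules. -/
def coinvFunctor (E : Entwining k P C) [IsEntwinedModule E P] :
    EntwinedModuleCat E ⥤ ModuleCat.{u} (coinvSubalgebra k C P)ᵐᵒᵖ where
  obj M := ModuleCat.of _ (coinvariants E M.carrier)
  map f := ModuleCat.ofHom (Hom.coinv f)

end EntwinedModuleCat

end

end

/-!
Write `B = P^{co C}`. The proof compares a general entwined module with the cofree modules `M ⊗ C`,
the induced modules `N ⊗_B P` and the multiples `P ⊗ V` of `P`.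

*Bijective counits are equivalent to full faithfulness.* This is the usual fact that a right adjoint
is fully faithful precisely if the counit is invertible. If every `σ_M` is bijective, a `B`-linear
`g : M^{co C} → N^{co C}` extends to `σ_N ∘ (g ⊗_B P) ∘ σ_M⁻¹`
(`EntwinedModuleCat.exists_coinv_eq`). Conversely fullness lifts the unit
`M^{co C} → (M^{co C} ⊗_B P)^{co C}` to a morphism `M → M^{co C} ⊗_B P`, which is inverse to `σ_M`.

*Flat Galois extensions have bijective counits.* If `can` is bijective, so is
`can_M : M ⊗_B P → M ⊗ C`, `m ⊗ p ↦ m · Δ_P(p)`, for every right `P`-module `M`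
(`IsCoalgebraGalois.bijective_canMapCoeff`). By flatness `- ⊗_B P` preserves the equalizer
`M^{co C} → M ⇉ M ⊗ C`, and the canonical maps turn the result into the equalizer
`M → M ⊗ C ⇉ M ⊗ C ⊗ C` given by coassociativity.

*Bijective counits imply Galois.* The invariants of `M ⊗ C` are `M` (`Cofree.unit_bijective`), and
under this identification `σ_{P ⊗ C}` is `can`. As `can` is right `P`-linear, the entwining is then
automatically the canonical one.

*Bijective counits imply flatness.* This is the Gabriel-Popescu theorem for the generator `P`, whose
endomorphism ring is `B`. Let `X` be entwined and let `F` be a `B`-submodule of `X^{co C}`. The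
kernel of `P ⊗ F → X` is an entwined module, hence generated by its invariants; these lie in
`(P ⊗ F)^{co C} = B ⊗ F`, so they die in `F ⊗_B P` already. Thus `F ⊗_B P → X` is injective
(`injective_counitMap_map`). For an injection `f : N → N'` this is applied to `X = P ⊗ N'` and to
the pullback `F` of `f` along `B ⊗ N' → N'`: an element of the kernel of `N ⊗_B P → N' ⊗_B P` lifts to
`F ⊗_B P`, and its image in `P ⊗ N'` is a sum of relations of `N' ⊗_B P`. Each such relation comes
from an element of `F ⊗_B P` which vanishes in `N ⊗_B P`, so injectivity finishes the argument.
-/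

noncomputable section

set_option maxSynthPendingDepth 3

/-! ### Balanced tensor products -/

namespace BalTensor

section

variable (k : Type v) [Field k] (B : Type u) [Ring B] [Algebra k B]
  {M M' M'' N N' : Type u}
  [AddCommGroup M] [Module k M] [Module Bᵐᵒᵖ M] [IsScalarTower k Bᵐᵒᵖ M]
  [AddCommGroup M'] [Module k M'] [Module Bᵐᵒᵖ M'] [IsScalarTower k Bᵐᵒᵖ M']
  [AddCommGroup M''] [Module k M''] [Module Bᵐᵒᵖ M''] [IsScalarTower k Bᵐᵒᵖ M'']
  [AddCommGroup N] [Module k N] [Module B N] [IsScalarTower k B N]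
  [AddCommGroup N'] [Module k N'] [Module B N'] [IsScalarTower k B N']
  {V : Type u} [AddCommGroup V] [Module k V]

/-- The universal balanced bilinear map `(m, n) ↦ m ⊗ n` into `M ⊗_B N`. -/
def mk (M N : Type u) [AddCommGroup M] [Module k M] [Module Bᵐᵒᵖ M]
    [AddCommGroup N] [Module k N] [Module B N] : M →ₗ[k] N →ₗ[k] BalTensor k B M N :=
  (TensorProduct.mk k M N).compr₂ (balancedRelations k B M N).mkQ

omit [Algebra k B] [IsScalarTower k Bᵐᵒᵖ M] [IsScalarTower k B N] in
theorem mk_op_smul (m : M) (b : B) (n : N) : mk k B M N (op b • m) n = mk k B M N m (b • n) :=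
  (Submodule.Quotient.eq _).2 (Submodule.subset_span ⟨m, b, n, rfl⟩)

theorem map_mk (f : M →ₗ[Bᵐᵒᵖ] M') (g : N →ₗ[B] N') (m : M) (n : N) :
    map k B f g (mk k B M N m n) = mk k B M' N' (f m) (g n) := rfl

omit [Algebra k B] [IsScalarTower k Bᵐᵒᵖ M] [IsScalarTower k B N] in
@[elab_as_elim]
theorem induction_on {p : BalTensor k B M N → Prop} (x : BalTensor k B M N) (zero : p 0)
    (mk : ∀ m n, p (mk k B M N m n)) (add : ∀ x y, p x → p y → p (x + y)) : p x := by
  obtain ⟨x, rfl⟩ := Submodule.mkQ_surjective _ x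
  induction x with
  | zero => simpa using zero
  | tmul m n => exact mk m n
  | add x y hx hy => rw [map_add]; exact add _ _ hx hy

theorem map_comp (g : M' →ₗ[Bᵐᵒᵖ] M'') (f : M →ₗ[Bᵐᵒᵖ] M') (x : BalTensor k B M N) :
    map k B (g ∘ₗ f) (LinearMap.id : N →ₗ[B] N) x =
      map k B g (LinearMap.id : N →ₗ[B] N) (map k B f LinearMap.id x) := by
  induction x using induction_on with
  | zero => simp only [map_zero]
  | mk m n => rfl
  | add x y hx hy => simp only [map_add, hx, hy]

theorem map_surjective {f : M →ₗ[Bᵐᵒᵖ] M'} (hf : Function.Surjective f) :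
    Function.Surjective (map k B f (LinearMap.id : N →ₗ[B] N)) := by
  intro y
  induction y using induction_on with
  | zero => exact ⟨0, map_zero _⟩
  | mk m n =>
    obtain ⟨m, rfl⟩ := hf m
    exact ⟨mk k B M N m n, rfl⟩
  | add x y hx hy =>
    obtain ⟨x, rfl⟩ := hx
    obtain ⟨y, rfl⟩ := hy
    exact ⟨x + y, map_add _ _ _⟩

theorem map_bijective {f : M →ₗ[Bᵐᵒᵖ] M'} (hf : Function.Bijective f) :
    Function.Bijective (map k B f (LinearMap.id : N →ₗ[B] N)) := by
  refine ⟨?_, map_surjective k B hf.2⟩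
  let e := LinearEquiv.ofBijective f hf
  have h : e.symm.toLinearMap ∘ₗ f = LinearMap.id := LinearMap.ext e.symm_apply_apply
  refine Function.LeftInverse.injective (g := map k B e.symm.toLinearMap LinearMap.id) fun t => ?_
  rw [← map_comp, h]
  induction t using induction_on with
  | zero => simp only [map_zero]
  | mk m n => rfl
  | add x y hx hy => rw [map_add, hx, hy]

omit [IsScalarTower k B N] in
/-- Along a surjection `f : M → M'`, the relations of `M' ⊗_B N` lift to relations of
`M ⊗_B N`. -/
theorem exists_mem_balancedRelations_of_surjective {f : M →ₗ[Bᵐᵒᵖ] M'}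
    (hf : Function.Surjective f) {x : M' ⊗[k] N} (hx : x ∈ balancedRelations k B M' N) :
    ∃ w ∈ balancedRelations k B M N, (f.restrictScalars k).rTensor N w = x := by
  induction hx using Submodule.span_induction with
  | mem x hx =>
    obtain ⟨m, b, n, rfl⟩ := hx
    obtain ⟨m, rfl⟩ := hf m
    exact ⟨_, Submodule.subset_span ⟨m, b, n, rfl⟩, by simp⟩
  | zero => exact ⟨0, zero_mem _, map_zero _⟩
  | add x y _ _ hx hy =>
    obtain ⟨a, ha, rfl⟩ := hx
    obtain ⟨b, hb, rfl⟩ := hy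
    exact ⟨a + b, add_mem ha hb, map_add _ _ _⟩
  | smul c x _ hx =>
    obtain ⟨a, ha, rfl⟩ := hx
    exact ⟨c • a, Submodule.smul_mem _ c ha, map_smul _ _ _⟩

/-- Right exactness of `- ⊗_B N`: if `M'' → M → M'` is exact and `M → M'` is surjective, then the
kernel of `M ⊗_B N → M' ⊗_B N` is the image of `M'' ⊗_B N`. -/
theorem exists_map_eq_of_exact {i : M'' →ₗ[Bᵐᵒᵖ] M} {f : M →ₗ[Bᵐᵒᵖ] M'}
    (hex : Function.Exact i f) (hf : Function.Surjective f)
    {y : BalTensor k B M N} (hy : map k B f (LinearMap.id : N →ₗ[B] N) y = 0) :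
    ∃ z : BalTensor k B M'' N, map k B i (LinearMap.id : N →ₗ[B] N) z = y := by
  obtain ⟨y, rfl⟩ := Submodule.mkQ_surjective _ y
  have hy' : (f.restrictScalars k).rTensor N y ∈ balancedRelations k B M' N :=
    (Submodule.Quotient.mk_eq_zero _).1 hy
  obtain ⟨w, hw, hwy⟩ := exists_mem_balancedRelations_of_surjective k B hf hy'
  have hex' : Function.Exact (i.restrictScalars k) (f.restrictScalars k) := hex
  obtain ⟨z, hz⟩ := (rTensor_exact N hex' hf (y - w)).1 (by rw [map_sub, hwy, sub_self])
  refine ⟨(balancedRelations k B M'' N).mkQ z, ?_⟩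
  have h : (i.restrictScalars k).rTensor N z - y ∈ balancedRelations k B M N := by
    rw [hz, sub_sub_cancel_left]
    exact neg_mem hw
  exact (Submodule.Quotient.eq _).2 h

end

end BalTensor

/-- Exactness of `- ⊗_B N` for a flat left `B`-module `N`. -/
theorem IsLeftFlat.exists_map_subtype_ker {k : Type v} [Field k] {B : Type u} [Ring B]
    [Algebra k B] {N : Type u} [AddCommGroup N] [Module k N] [Module B N] [IsScalarTower k B N]
    (h : IsLeftFlat k B N) {M M' : Type u}
    [AddCommGroup M] [Module k M] [Module Bᵐᵒᵖ M] [IsScalarTower k Bᵐᵒᵖ M]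
    [AddCommGroup M'] [Module k M'] [Module Bᵐᵒᵖ M'] [IsScalarTower k Bᵐᵒᵖ M']
    {f : M →ₗ[Bᵐᵒᵖ] M'} {y : BalTensor k B M N}
    (hy : BalTensor.map k B f (LinearMap.id : N →ₗ[B] N) y = 0) :
    ∃ z : BalTensor k B (LinearMap.ker f) N,
      BalTensor.map k B (LinearMap.ker f).subtype (LinearMap.id : N →ₗ[B] N) z = y := by
  have h1 : BalTensor.map k B f.rangeRestrict (LinearMap.id : N →ₗ[B] N) y = 0 := by
    apply h _ _ (LinearMap.range f).subtype Subtype.val_injective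
    rw [← BalTensor.map_comp, map_zero]
    exact hy
  have hex : Function.Exact (LinearMap.ker f).subtype f.rangeRestrict := fun m => by
    simp [Subtype.ext_iff]
  exact BalTensor.exists_map_eq_of_exact k B hex f.surjective_rangeRestrict h1

/-! ### The actions attached to an entwining structure -/

section

variable {k : Type v} [Field k] {P : Type u} [Ring P] [Algebra k P]
  {C : Type u} [AddCommGroup C] [Module k C]

theorem actTensor_tmul {M : Type u} [AddCommGroup M] [Module k M] [Module Pᵐᵒᵖ M]
    [IsScalarTower k Pᵐᵒᵖ M] (m : M) (p : P) (c : C) :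
    actTensor k P C M m (p ⊗ₜ[k] c) = (op p • m) ⊗ₜ[k] c := rfl

theorem actTensor_eq_smul (p : P) (x : P ⊗[k] C) : actTensor k P C P p x = p • x := by
  induction x with
  | zero => simp
  | add x y hx hy => rw [map_add, hx, hy, smul_add]
  | tmul q c => rfl

theorem rTensor_actTensor {M N : Type u} [AddCommGroup M] [Module k M] [Module Pᵐᵒᵖ M]
    [IsScalarTower k Pᵐᵒᵖ M] [AddCommGroup N] [Module k N] [Module Pᵐᵒᵖ N]
    [IsScalarTower k Pᵐᵒᵖ N] (f : M →ₗ[Pᵐᵒᵖ] N) (m : M) (x : P ⊗[k] C) :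
    (f.restrictScalars k).rTensor C (actTensor k P C M m x) = actTensor k P C N (f m) x := by
  induction x with
  | zero => simp
  | add x y hx hy => simp only [map_add, hx, hy]
  | tmul q c => simp [actTensor_tmul]

end

section

variable {k : Type v} [Field k] {P : Type u} [Ring P] [Algebra k P]
  {C : Type u} [AddCommGroup C] [Module k C] [Coalgebra k C]
  {M : Type u} [AddCommGroup M] [Module k M] [Module Pᵐᵒᵖ M] [IsScalarTower k Pᵐᵒᵖ M]
  {N : Type u} [AddCommGroup N] [Module k N] [Module Pᵐᵒᵖ N] [IsScalarTower k Pᵐᵒᵖ N]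

namespace Entwining

variable (E : Entwining k P C)

theorem act_tmul (m : M) (c : C) (p : P) :
    E.act M p (m ⊗ₜ[k] c) = actTensor k P C M m (E.ψ (c ⊗ₜ[k] p)) := rfl

theorem ψ_mul (c : C) (p q : P) : E.ψ (c ⊗ₜ[k] (p * q)) = E.act P q (E.ψ (c ⊗ₜ[k] p)) := by
  have h := LinearMap.congr_fun E.mul (c ⊗ₜ[k] (p ⊗ₜ[k] q))
  simp only [LinearMap.comp_apply, LinearMap.lTensor_tmul, LinearMap.mul'_apply,
    LinearEquiv.coe_coe, TensorProduct.assoc_symm_tmul, LinearMap.rTensor_tmul] at h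
  rw [h]
  induction E.ψ (c ⊗ₜ[k] p) with
  | zero => simp
  | add x y hx hy => simp only [TensorProduct.add_tmul, map_add, hx, hy]
  | tmul r d =>
    rw [TensorProduct.assoc_tmul, LinearMap.lTensor_tmul, act_tmul, actTensor_eq_smul]
    induction E.ψ (d ⊗ₜ[k] q) with
    | zero => simp
    | add x y hx hy => simp only [TensorProduct.tmul_add, map_add, hx, hy, smul_add]
    | tmul s e => simp [TensorProduct.smul_tmul']

theorem act_one (x : M ⊗[k] C) : E.act M 1 x = x := by
  induction x with
  | zero => simp
  | add x y hx hy => rw [map_add, hx, hy]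
  | tmul m c => rw [act_tmul, E.one, actTensor_tmul, MulOpposite.op_one, one_smul]

theorem act_mul (p q : P) (x : M ⊗[k] C) : E.act M (p * q) x = E.act M q (E.act M p x) := by
  induction x with
  | zero => simp
  | add x y hx hy => simp only [map_add, hx, hy]
  | tmul m c => rw [act_tmul, act_tmul, E.ψ_mul, E.act_actTensor]

theorem act_add (p q : P) (x : M ⊗[k] C) : E.act M (p + q) x = E.act M p x + E.act M q x := by
  induction x with
  | zero => simp
  | add x y hx hy => simp only [map_add, hx, hy]; abel
  | tmul m c => simp only [act_tmul, TensorProduct.tmul_add, map_add]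

theorem act_smul (r : k) (p : P) (x : M ⊗[k] C) : E.act M (r • p) x = r • E.act M p x := by
  induction x with
  | zero => simp
  | add x y hx hy => simp only [map_add, hx, hy, smul_add]
  | tmul m c => simp only [act_tmul, TensorProduct.tmul_smul, map_smul]

/-- The right `P`-action on `M ⊗ C` is natural in `M`. -/
theorem rTensor_act (f : M →ₗ[Pᵐᵒᵖ] N) (p : P) (x : M ⊗[k] C) :
    (f.restrictScalars k).rTensor C (E.act M p x) =
      E.act N p ((f.restrictScalars k).rTensor C x) := by
  induction x with
  | zero => simp
  | add x y hx hy => simp only [map_add, hx, hy]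
  | tmul m c => simp only [act_tmul, rTensor_actTensor, LinearMap.rTensor_tmul]; rfl

end Entwining

/-- The coaction of an entwined module on `m p`, for `m` a coaction invariant. -/
theorem coact_op_smul_of_mem_coinvariants (E : Entwining k P C) [RightComodule k C P]
    [IsEntwinedModule E P] [RightComodule k C M] [IsEntwinedModule E M] {m : M}
    (hm : m ∈ coinvariants E M) (p : P) :
    RightComodule.coact (k := k) (C := C) (op p • m) =
      actTensor k P C M m (RightComodule.coact (k := k) (C := C) p) := by
  have hm' : RightComodule.coact (k := k) (C := C) m =
    actTensor k P C M m (RightComodule.coact (k := k) (C := C) (1 : P)) := hm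
  rw [IsEntwinedModule.coact_smul (E := E), hm', E.act_actTensor,
    ← IsEntwinedModule.coact_smul (E := E), op_smul_eq_mul, one_mul]

/-- `B = P^{co C}` consists of the coaction invariants of the entwined module `P`. -/
theorem mem_coinvSubalgebra_iff (E : Entwining k P C) [RightComodule k C P]
    [IsEntwinedModule E P] (b : P) : b ∈ coinvSubalgebra k C P ↔
      RightComodule.coact (k := k) (C := C) b =
        b • RightComodule.coact (k := k) (C := C) (1 : P) := by
  refine ⟨fun h => coact_coinv ⟨b, h⟩, fun h p => ?_⟩
  have h' : b ∈ coinvariants E P := h.trans (actTensor_eq_smul _ _).symm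
  have := coact_op_smul_of_mem_coinvariants E h' p
  rwa [op_smul_eq_mul, actTensor_eq_smul] at this

/-- In a right comodule, the two ways of coacting twice agree. -/
theorem RightComodule.rTensor_coact_coact [RightComodule k C M] (m : M) :
    (RightComodule.coact (k := k) (C := C) (M := M)).rTensor C (RightComodule.coact m) =
      (TensorProduct.assoc k M C C).symm ((Coalgebra.comul (R := k) (A := C)).lTensor M
        (RightComodule.coact m)) := by
  rw [LinearEquiv.eq_symm_apply]
  exact LinearMap.congr_fun (RightComodule.coassoc (k := k) (C := C) (M := M)) m

theorem RightComodule.lTensor_counit_coact [RightComodule k C M] (m : M) :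
    (TensorProduct.rid k M) ((Coalgebra.counit (R := k) (A := C)).lTensor M
        (RightComodule.coact m)) = m :=
  LinearMap.congr_fun (RightComodule.counit (k := k) (C := C) (M := M)) m

theorem RightComodule.coact_injective [RightComodule k C M] :
    Function.Injective (RightComodule.coact (k := k) (C := C) (M := M)) :=
  fun m n h => by rw [← lTensor_counit_coact (k := k) (C := C) m, h, lTensor_counit_coact]

end

/-! ### Entwined modules generated or cogenerated by entwined modules -/

section

variable {k : Type v} [Field k] {P : Type u} [Ring P] [Algebra k P]
  {C : Type u} [AddCommGroup C] [Module k C] [Coalgebra k C]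
  {M : Type u} [AddCommGroup M] [Module k M]
  {X : Type u} [AddCommGroup X] [Module k X]

omit [Coalgebra k C] in
theorem LinearMap.lTensor_rTensor_apply {V W : Type*} [AddCommGroup V] [Module k V] [AddCommGroup W]
    [Module k W] (f : V →ₗ[k] W) {U : Type*} [AddCommGroup U] [Module k U] (g : C →ₗ[k] U)
    (x : V ⊗[k] C) : g.lTensor W (f.rTensor C x) = f.rTensor U (g.lTensor V x) := by
  rw [← LinearMap.comp_apply, ← LinearMap.comp_apply, LinearMap.lTensor_comp_rTensor,
    LinearMap.rTensor_comp_lTensor]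

omit [Coalgebra k C] in
theorem assoc_rTensor_rTensor (f : M →ₗ[k] X) (x : (M ⊗[k] C) ⊗[k] C) :
    TensorProduct.assoc k X C C ((f.rTensor C).rTensor C x) =
      f.rTensor (C ⊗[k] C) (TensorProduct.assoc k M C C x) := by
  have : (TensorProduct.assoc k X C C).toLinearMap ∘ₗ (f.rTensor C).rTensor C =
      f.rTensor (C ⊗[k] C) ∘ₗ (TensorProduct.assoc k M C C).toLinearMap := by
    ext; rfl
  exact LinearMap.congr_fun this x

/-- If `f : M → X` intertwines `ρ` and `ρ'`, both sides of coassociativity for `ρ'` at `f m` are the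
images of those for `ρ` at `m`. -/
theorem coassoc_transport {ρ : M →ₗ[k] M ⊗[k] C} {ρ' : X →ₗ[k] X ⊗[k] C} {f : M →ₗ[k] X}
    (hf : ∀ m, ρ' (f m) = f.rTensor C (ρ m)) (m : M) :
    TensorProduct.assoc k X C C (ρ'.rTensor C (ρ' (f m))) =
        f.rTensor (C ⊗[k] C) (TensorProduct.assoc k M C C (ρ.rTensor C (ρ m))) ∧
      (Coalgebra.comul (R := k) (A := C)).lTensor X (ρ' (f m)) =
        f.rTensor (C ⊗[k] C) ((Coalgebra.comul (R := k) (A := C)).lTensor M (ρ m)) := by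
  have hf' : ρ' ∘ₗ f = f.rTensor C ∘ₗ ρ := LinearMap.ext hf
  refine ⟨?_, ?_⟩
  · rw [hf, ← assoc_rTensor_rTensor, ← LinearMap.comp_apply (f := ρ'.rTensor C),
      ← LinearMap.rTensor_comp, hf', LinearMap.rTensor_comp, LinearMap.comp_apply]
  · rw [hf, LinearMap.lTensor_rTensor_apply]

/-- If `f : M → X` intertwines `ρ` and `ρ'`, then `(X ⊗ ε) ρ'(f m)` is the image of
`(M ⊗ ε) ρ(m)`. -/
theorem counit_transport {ρ : M →ₗ[k] M ⊗[k] C} {ρ' : X →ₗ[k] X ⊗[k] C} {f : M →ₗ[k] X}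
    (hf : ∀ m, ρ' (f m) = f.rTensor C (ρ m)) (m : M) :
    TensorProduct.rid k X ((Coalgebra.counit (R := k) (A := C)).lTensor X (ρ' (f m))) =
      f (TensorProduct.rid k M ((Coalgebra.counit (R := k) (A := C)).lTensor M (ρ m))) := by
  rw [hf, LinearMap.lTensor_rTensor_apply]
  induction (Coalgebra.counit (R := k) (A := C)).lTensor M (ρ m) with
  | zero => simp
  | add x y hx hy => simp only [map_add, hx, hy]
  | tmul m r => simp

/-- A coaction-like map `ρ` on `X` is a coaction if `X` is spanned by the images of linear maps
from a comodule which intertwine its coaction with `ρ`. -/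
@[reducible]
def RightComodule.ofSpan [RightComodule k C M] (ρ : X →ₗ[k] X ⊗[k] C) {ι : Type*}
    (f : ι → M →ₗ[k] X)
    (hf : ∀ i m, ρ (f i m) = (f i).rTensor C (RightComodule.coact (k := k) (C := C) m))
    (hspan : Submodule.span k {x | ∃ i m, f i m = x} = ⊤) : RightComodule k C X where
  coact := ρ
  coassoc := by
    refine LinearMap.ext_on hspan ?_
    rintro _ ⟨i, m, rfl⟩
    obtain ⟨h1, h2⟩ := coassoc_transport (hf i) m
    have h := LinearMap.congr_fun (RightComodule.coassoc (k := k) (C := C) (M := M)) m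
    simp only [LinearMap.comp_apply, LinearEquiv.coe_coe] at h ⊢
    rw [h1, h2, h]
  counit := by
    refine LinearMap.ext_on hspan ?_
    rintro _ ⟨i, m, rfl⟩
    exact (counit_transport (hf i) m).trans (by rw [RightComodule.lTensor_counit_coact]; rfl)

/-- A linear map `ρ` on `M` is a coaction if `M` embeds into a comodule by a map intertwining `ρ`
with the coaction; this uses that tensoring over the field `k` preserves injectivity. -/
@[reducible]
def RightComodule.ofInjective [RightComodule k C X] (ρ : M →ₗ[k] M ⊗[k] C) (f : M →ₗ[k] X)
    (hf : ∀ m, RightComodule.coact (k := k) (C := C) (f m) = f.rTensor C (ρ m))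
    (hinj : Function.Injective f) : RightComodule k C M where
  coact := ρ
  coassoc := by
    ext m
    obtain ⟨h1, h2⟩ := coassoc_transport hf m
    have h := LinearMap.congr_fun (RightComodule.coassoc (k := k) (C := C) (M := X)) (f m)
    simp only [LinearMap.comp_apply, LinearEquiv.coe_coe] at h ⊢
    exact Module.Flat.rTensor_preserves_injective_linearMap f hinj (h1.symm.trans (h.trans h2))
  counit := by
    ext m
    exact hinj ((counit_transport hf m).symm.trans (RightComodule.lTensor_counit_coact _))

variable [Module Pᵐᵒᵖ M] [IsScalarTower k Pᵐᵒᵖ M] [Module Pᵐᵒᵖ X] [IsScalarTower k Pᵐᵒᵖ X]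
  [RightComodule k C M] [RightComodule k C X] (E : Entwining k P C)

theorem IsEntwinedModule.of_span [IsEntwinedModule E M] {ι : Type*} (f : ι → M →ₗ[Pᵐᵒᵖ] X)
    (hf : ∀ i m, RightComodule.coact (k := k) (C := C) (f i m) =
      ((f i).restrictScalars k).rTensor C (RightComodule.coact (k := k) (C := C) m))
    (hspan : Submodule.span k {x | ∃ i m, f i m = x} = ⊤) : IsEntwinedModule E X where
  coact_smul x p := by
    have hx : x ∈ Submodule.span k {x | ∃ i m, f i m = x} := hspan ▸ Submodule.mem_top
    induction hx using Submodule.span_induction with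
    | mem x hx =>
      obtain ⟨i, m, rfl⟩ := hx
      rw [← map_smul, hf, hf, IsEntwinedModule.coact_smul (E := E), E.rTensor_act]
    | zero => simp
    | add x y _ _ hx hy => rw [smul_add, map_add, hx, hy, map_add, map_add]
    | smul c x _ hx =>
      have : op p • c • x = c • op p • x := (rightAct k P X).map_smul₂ c x p
      rw [this, map_smul, hx, map_smul, map_smul]

theorem IsEntwinedModule.of_injective [IsEntwinedModule E X] (f : M →ₗ[Pᵐᵒᵖ] X)
    (hf : ∀ m, RightComodule.coact (k := k) (C := C) (f m) =
      (f.restrictScalars k).rTensor C (RightComodule.coact (k := k) (C := C) m))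
    (hinj : Function.Injective f) : IsEntwinedModule E M where
  coact_smul m p := by
    apply Module.Flat.rTensor_preserves_injective_linearMap (M := C) (f.restrictScalars k) hinj
    rw [← hf, map_smul, IsEntwinedModule.coact_smul (E := E), hf, E.rTensor_act]

end

/-! ### Cofree entwined modules -/

section

variable {k : Type v} [Field k] {P : Type u} [Ring P] [Algebra k P]
  {C : Type u} [AddCommGroup C] [Module k C] [Coalgebra k C]

/-- The comodule `C` over itself. -/
@[reducible]
def RightComodule.self (k : Type v) [Field k] (C : Type u) [AddCommGroup C] [Module k C]
    [Coalgebra k C] : RightComodule k C C where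
  coact := Coalgebra.comul
  coassoc := Coalgebra.coassoc
  counit := by
    ext c
    simp [Coalgebra.lTensor_counit_comul]

/-- The cofree entwined module `M ⊗ C` on a right `P`-module `M`, with action
`(m ⊗ c) p = m · ψ(c ⊗ p)` and coaction `M ⊗ Δ`. It is a synonym of `M ⊗[k] C`, as the latter
already carries the `P`-action on the factor `M`. -/
@[nolint unusedArguments]
def Cofree (_E : Entwining k P C) (M : Type u) [AddCommGroup M] [Module k M] : Type u :=
  M ⊗[k] C

namespace Cofree

variable (E : Entwining k P C) (M : Type u) [AddCommGroup M] [Module k M]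

instance : AddCommGroup (Cofree E M) := inferInstanceAs (AddCommGroup (M ⊗[k] C))

instance : Module k (Cofree E M) := inferInstanceAs (Module k (M ⊗[k] C))

/-- The identity map from `M ⊗ C` to its synonym. -/
def of : M ⊗[k] C ≃ₗ[k] Cofree E M := LinearEquiv.refl k (M ⊗[k] C)

/-- The map `M ⊗ Δ`, rebracketed. -/
def comul (C : Type u) [AddCommGroup C] [Module k C] [Coalgebra k C]
    (M : Type u) [AddCommGroup M] [Module k M] : M ⊗[k] C →ₗ[k] (M ⊗[k] C) ⊗[k] C :=
  (TensorProduct.assoc k M C C).symm.toLinearMap ∘ₗ (Coalgebra.comul (R := k) (A := C)).lTensor M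

variable {M} in
theorem comul_tmul (m : M) (c : C) :
    comul C M (m ⊗ₜ[k] c) = (TensorProduct.mk k M C m).rTensor C (Coalgebra.comul c) := by
  rw [comul, LinearMap.comp_apply, LinearMap.lTensor_tmul]
  induction Coalgebra.comul (R := k) c with
  | zero => simp
  | add x y hx hy => simp only [TensorProduct.tmul_add, map_add, hx, hy]
  | tmul d e => rfl

instance : RightComodule k C (Cofree E M) :=
  letI := RightComodule.self k C
  RightComodule.ofSpan ((of E M).toLinearMap.rTensor C ∘ₗ comul C M ∘ₗ (of E M).symm.toLinearMap)
    (fun m => (of E M).toLinearMap ∘ₗ TensorProduct.mk k M C m)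
    (fun m c => by
      simp only [LinearMap.comp_apply, LinearEquiv.coe_coe, LinearEquiv.symm_apply_apply,
        TensorProduct.mk_apply, comul_tmul, LinearMap.rTensor_comp]
      rfl)
    (TensorProduct.span_tmul_eq_top k M C)

theorem coact_of (x : M ⊗[k] C) : RightComodule.coact (k := k) (C := C) (of E M x) =
    (of E M).toLinearMap.rTensor C (comul C M x) := rfl

variable [Module Pᵐᵒᵖ M] [IsScalarTower k Pᵐᵒᵖ M]

instance : Module Pᵐᵒᵖ (Cofree E M) where
  smul p x := E.act M p.unop x
  one_smul x := E.act_one x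
  mul_smul p q x := E.act_mul q.unop p.unop x
  smul_zero p := map_zero (E.act M p.unop)
  smul_add p x y := map_add (E.act M p.unop) x y
  add_smul p q x := E.act_add p.unop q.unop x
  zero_smul x := by
    have := E.act_smul 0 (0 : P) x
    rwa [zero_smul, zero_smul] at this

instance : IsScalarTower k Pᵐᵒᵖ (Cofree E M) where
  smul_assoc r p x := E.act_smul r p.unop x

theorem op_smul_of (p : P) (x : M ⊗[k] C) : op p • of E M x = of E M (E.act M p x) := rfl

/-- The right pentagon of the entwining, with `M ⊗ Δ` on one side and the action on the cofree
module on the other. -/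
theorem comul_ψ (c : C) (p : P) : comul C P (E.ψ (c ⊗ₜ[k] p)) =
    E.ψ.rTensor C ((TensorProduct.assoc k C P C).symm (E.ψ.lTensor C
      (TensorProduct.assoc k C C P (Coalgebra.comul (R := k) c ⊗ₜ[k] p)))) := by
  have h := LinearMap.congr_fun E.comul (c ⊗ₜ[k] p)
  simp only [LinearMap.comp_apply, LinearEquiv.coe_coe, LinearMap.rTensor_tmul] at h
  rw [comul, LinearMap.comp_apply, LinearEquiv.coe_coe, h, LinearEquiv.symm_apply_apply]

theorem comul_actTensor (m : M) (x : P ⊗[k] C) :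
    comul C M (actTensor k P C M m x) =
      (actTensor k P C M m).rTensor C (comul C P x) := by
  induction x with
  | zero => simp
  | add x y hx hy => simp only [map_add, hx, hy]
  | tmul p c =>
    rw [actTensor_tmul, comul_tmul, comul_tmul]
    induction Coalgebra.comul (R := k) c with
    | zero => simp
    | add x y hx hy => simp only [map_add, hx, hy]
    | tmul d e => rfl

/-- The map `m · (-)` into a cofree module, in terms of the map `m · (-)` into `M ⊗ C`. -/
theorem actTensor_of_tmul (m : M) (c : C) (y : P ⊗[k] C) :
    actTensor k P C (Cofree E M) (of E M (m ⊗ₜ[k] c)) y =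
      (of E M).toLinearMap.rTensor C ((actTensor k P C M m).rTensor C
        (E.ψ.rTensor C ((TensorProduct.assoc k C P C).symm (c ⊗ₜ[k] y)))) := by
  induction y with
  | zero => simp
  | add x y hx hy => simp only [TensorProduct.tmul_add, map_add, hx, hy]
  | tmul q f => rfl

instance : IsEntwinedModule E (Cofree E M) where
  coact_smul x p := by
    obtain ⟨x, rfl⟩ := (of E M).surjective x
    rw [op_smul_of, coact_of, coact_of]
    induction x with
    | zero => simp only [map_zero]
    | add x y hx hy => simp only [map_add, hx, hy]
    | tmul m c =>
      rw [E.act_tmul, comul_actTensor, comul_ψ, comul_tmul]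
      induction Coalgebra.comul (R := k) c with
      | zero => simp only [TensorProduct.zero_tmul, map_zero]
      | add x y hx hy => simp only [TensorProduct.add_tmul, map_add, hx, hy]
      | tmul d e =>
        rw [TensorProduct.assoc_tmul, LinearMap.lTensor_tmul, LinearMap.rTensor_tmul,
          LinearMap.rTensor_tmul, E.act_tmul, LinearEquiv.coe_coe, TensorProduct.mk_apply,
          actTensor_of_tmul]

end Cofree

end

section

variable {k : Type v} [Field k] {P : Type u} [Ring P] [Algebra k P]
  {C : Type u} [AddCommGroup C] [Module k C] [Coalgebra k C] [RightComodule k C P]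

/-! ### The canonical map with coefficients -/

theorem canMap_mk (p q : P) :
    canMap k C P (BalTensor.mk k (coinvSubalgebra k C P) P P p q) =
      p • RightComodule.coact (k := k) (C := C) q := rfl

theorem canMap_translationMap (h : IsCoalgebraGalois k C P) (c : C) :
    canMap k C P (translationMap h c) = 1 ⊗ₜ[k] c :=
  (LinearEquiv.ofBijective (canMap k C P) h).apply_symm_apply _

/-- The canonical map is right `P`-linear, so that `ψ` is determined by it. -/
theorem canMap_rightMulBal (E : Entwining k P C) [IsEntwinedModule E P] (r : P)
    (t : BalTensor k (coinvSubalgebra k C P) P P) :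
    canMap k C P (rightMulBal k C P r t) = E.act P r (canMap k C P t) := by
  induction t using BalTensor.induction_on with
  | zero => simp only [map_zero]
  | add x y hx hy => simp only [map_add, hx, hy]
  | mk p q =>
    have h : rightMulBal k C P r (BalTensor.mk k (coinvSubalgebra k C P) P P p q) =
      BalTensor.mk k (coinvSubalgebra k C P) P P p (q * r) := rfl
    rw [h, canMap_mk, canMap_mk, ← actTensor_eq_smul, ← actTensor_eq_smul, E.act_actTensor,
      ← IsEntwinedModule.coact_smul (E := E), op_smul_eq_mul]

/-- If `P` is an entwined module and the canonical map is bijective, then the given entwining is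
the canonical one. -/
theorem IsCoalgebraGalois.isCanonicalEntwining (h : IsCoalgebraGalois k C P) (E : Entwining k P C)
    [IsEntwinedModule E P] : IsCanonicalEntwining h E := fun c p => by
  rw [canMap_rightMulBal E, canMap_translationMap, E.act_tmul, actTensor_eq_smul, one_smul]

variable (k C P)

variable (M : Type u) [AddCommGroup M] [Module k M] [Module Pᵐᵒᵖ M] [IsScalarTower k Pᵐᵒᵖ M]

/-- The canonical map with coefficients in a right `P`-module `M`: the map
`M ⊗_B P → M ⊗ C`, `m ⊗ p ↦ m · Δ_P(p)`. -/
def canMapCoeff : BalTensor k (coinvSubalgebra k C P) M P →ₗ[k] M ⊗[k] C :=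
  BalTensor.lift k (coinvSubalgebra k C P)
    ((actTensor k P C M).compl₂ (RightComodule.coact (k := k) (C := C)))
    (by
      intro m b q
      change actTensor k P C M (op (b : P) • m) (RightComodule.coact q) =
        actTensor k P C M m (RightComodule.coact ((b : P) * q))
      rw [actTensor_op_smul, b.2 q])

/-- The map `P ⊗_B P → M ⊗_B P`, `p ⊗ q ↦ m p ⊗ q`, linear in `m ∈ M`. -/
def actBal : M →ₗ[k] BalTensor k (coinvSubalgebra k C P) P P →ₗ[k]
    BalTensor k (coinvSubalgebra k C P) M P :=
  LinearMap.flip (BalTensor.lift k (coinvSubalgebra k C P)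
    (LinearMap.mk₂ k (fun p q => (BalTensor.mk k (coinvSubalgebra k C P) M P).flip q ∘ₗ
        (rightAct k P M).flip p)
      (fun _ _ _ => by ext; simp)
      (fun _ _ _ => by ext; simp)
      (fun _ _ _ => by ext; simp)
      (fun _ _ _ => by ext; simp))
    (by
      intro p b q
      ext m
      change BalTensor.mk k (coinvSubalgebra k C P) M P (op (p * (b : P)) • m) q =
        BalTensor.mk k (coinvSubalgebra k C P) M P (op p • m) (b • q)
      rw [← BalTensor.mk_op_smul, coinv_op_smul, smul_smul, MulOpposite.op_mul]))

variable {k C P M}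

theorem canMapCoeff_mk (m : M) (q : P) :
    canMapCoeff k P C M (BalTensor.mk k (coinvSubalgebra k C P) M P m q) =
      actTensor k P C M m (RightComodule.coact (k := k) (C := C) q) := rfl

theorem actBal_mk (m : M) (p q : P) :
    actBal k P C M m (BalTensor.mk k (coinvSubalgebra k C P) P P p q) =
      BalTensor.mk k (coinvSubalgebra k C P) M P (op p • m) q := rfl

theorem actBal_op_smul (m : M) (p : P) (t : BalTensor k (coinvSubalgebra k C P) P P) :
    actBal k P C M (op p • m) t = actBal k P C M m (actBal k P C P p t) := by
  induction t using BalTensor.induction_on with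
  | zero => simp only [map_zero]
  | add x y hx hy => simp only [map_add, hx, hy]
  | mk a b => rw [actBal_mk, actBal_mk, actBal_mk, smul_smul, op_smul_eq_mul, MulOpposite.op_mul]

theorem canMap_eq_canMapCoeff : canMap k C P = canMapCoeff k P C P := by
  ext p q
  exact (actTensor_eq_smul p _).symm

theorem canMapCoeff_actBal (m : M) (t : BalTensor k (coinvSubalgebra k C P) P P) :
    canMapCoeff k P C M (actBal k P C M m t) = actTensor k P C M m (canMap k C P t) := by
  induction t using BalTensor.induction_on with
  | zero => simp only [map_zero]
  | add x y hx hy => simp only [map_add, hx, hy]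
  | mk a b => rw [actBal_mk, canMapCoeff_mk, actTensor_op_smul, canMap_mk]

theorem canMap_actBal_translationMap (h : IsCoalgebraGalois k C P) (p : P) (c : C) :
    canMap k C P (actBal k P C P p (translationMap h c)) = p ⊗ₜ[k] c := by
  rw [canMap_eq_canMapCoeff, canMapCoeff_actBal, canMap_translationMap, actTensor_tmul,
    MulOpposite.op_one, one_smul]

variable (M) in
/-- For a coalgebra-Galois extension `M ⊗_B P ≅ M ⊗_P (P ⊗_B P) ≅ M ⊗_P (P ⊗ C) ≅ M ⊗ C`, for all
right `P`-modules `M`. -/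
theorem IsCoalgebraGalois.bijective_canMapCoeff (h : IsCoalgebraGalois k C P) :
    Function.Bijective (canMapCoeff k P C M) := by
  let inv : M ⊗[k] C →ₗ[k] BalTensor k (coinvSubalgebra k C P) M P :=
    TensorProduct.lift ((actBal k P C M).compl₂ (translationMap h))
  -- by definition `inv` maps `m · x` to `m · can⁻¹(x)` for `x = 1 ⊗ c`; this extends to all `x`, as
  -- `can` is left `P`-linear
  have inv_actTensor (m : M) (t : BalTensor k (coinvSubalgebra k C P) P P) :
      inv (actTensor k P C M m (canMap k C P t)) = actBal k P C M m t := by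
    obtain ⟨x, rfl⟩ := (LinearEquiv.ofBijective (canMap k C P) h).symm.surjective t
    have hx : canMap k C P ((LinearEquiv.ofBijective (canMap k C P) h).symm x) = x :=
      (LinearEquiv.ofBijective (canMap k C P) h).apply_symm_apply _
    rw [hx]
    clear hx
    induction x with
    | zero => simp only [map_zero]
    | add x y hx hy => simp only [map_add, hx, hy]
    | tmul p c =>
      rw [actTensor_tmul, (LinearEquiv.ofBijective (canMap k C P) h).symm_apply_eq.2
          (canMap_actBal_translationMap h p c).symm,
        ← actBal_op_smul]
      rfl
  refine Function.bijective_iff_has_inverse.2 ⟨inv, fun t => ?_, fun x => ?_⟩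
  · induction t using BalTensor.induction_on with
    | zero => simp only [map_zero]
    | add x y hx hy => simp only [map_add, hx, hy]
    | mk m q =>
      have h1 := inv_actTensor m (BalTensor.mk k (coinvSubalgebra k C P) P P 1 q)
      rwa [canMap_mk, one_smul, actBal_mk, MulOpposite.op_one, one_smul] at h1
  · induction x with
    | zero => simp only [map_zero]
    | add x y hx hy => simp only [map_add, hx, hy]
    | tmul m c =>
      have h1 : inv (m ⊗ₜ[k] c) = actBal k P C M m (translationMap h c) := rfl
      rw [h1, canMapCoeff_actBal, canMap_translationMap, actTensor_tmul, MulOpposite.op_one,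
        one_smul]

/-! ### Coaction invariants of a cofree module -/

variable (E : Entwining k P C) [IsEntwinedModule E P]

namespace Cofree

theorem op_smul_of_actTensor_coact_one (m : M) (p : P) :
    op p • of E M (actTensor k P C M m (RightComodule.coact (1 : P))) =
      of E M (actTensor k P C M m (RightComodule.coact p)) := by
  rw [op_smul_of, E.act_actTensor, ← IsEntwinedModule.coact_smul (E := E), op_smul_eq_mul, one_mul]

theorem actTensor_of_actTensor_coact_one (m : M) (y : P ⊗[k] C) :
    actTensor k P C (Cofree E M) (of E M (actTensor k P C M m (RightComodule.coact (1 : P)))) y =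
      (of E M).toLinearMap.rTensor C ((actTensor k P C M m).rTensor C
        ((RightComodule.coact (k := k) (C := C) (M := P)).rTensor C y)) := by
  induction y with
  | zero => simp only [map_zero]
  | add x y hx hy => simp only [map_add, hx, hy]
  | tmul p c => rw [actTensor_tmul, op_smul_of_actTensor_coact_one]; rfl

/-- On elements `m · Δ_P(1)` of `M ⊗ C`, the action of `Δ_P(p)` is `(M ⊗ Δ)(m · Δ_P(p))`. -/
theorem actTensor_of_actTensor_coact_one_coact (m : M) (p : P) :
    actTensor k P C (Cofree E M) (of E M (actTensor k P C M m (RightComodule.coact (1 : P))))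
        (RightComodule.coact p) =
      (of E M).toLinearMap.rTensor C (comul C M (actTensor k P C M m (RightComodule.coact p))) := by
  rw [actTensor_of_actTensor_coact_one, comul_actTensor, RightComodule.rTensor_coact_coact]
  rfl

variable (M) in
/-- The map `M → (M ⊗ C)^{co C}`, `m ↦ m · Δ_P(1)`. -/
def unit : M →ₗ[(coinvSubalgebra k C P)ᵐᵒᵖ] coinvariants E (Cofree E M) where
  toFun m := ⟨of E M (actTensor k P C M m (RightComodule.coact (1 : P))),
    (actTensor_of_actTensor_coact_one_coact E m 1).symm⟩
  map_add' m n := Subtype.ext (by simp)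
  map_smul' b m := Subtype.ext (by
    obtain ⟨b, rfl⟩ := MulOpposite.op_surjective b
    change of E M (actTensor k P C M (op (b : P) • m) (RightComodule.coact (1 : P))) =
      op (b : P) • of E M (actTensor k P C M m (RightComodule.coact (1 : P)))
    rw [op_smul_of_actTensor_coact_one, actTensor_op_smul, ← coact_coinv])

omit [RightComodule k C P] in
theorem rid_lTensor_counit_actTensor (m : M) (x : P ⊗[k] C) :
    TensorProduct.rid k M ((Coalgebra.counit (R := k) (A := C)).lTensor M
        (actTensor k P C M m x)) =
      rightAct k P M m (TensorProduct.rid k P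
        ((Coalgebra.counit (R := k) (A := C)).lTensor P x)) := by
  induction x with
  | zero => simp only [map_zero]
  | add x y hx hy => simp only [map_add, hx, hy]
  | tmul p c =>
    rw [actTensor_tmul, LinearMap.lTensor_tmul, LinearMap.lTensor_tmul, TensorProduct.rid_tmul,
      TensorProduct.rid_tmul, map_smul]
    rfl

omit [RightComodule k C P] [IsEntwinedModule E P] in
theorem rid_lTensor_counit_act (p : P) (x : M ⊗[k] C) :
    TensorProduct.rid k M ((Coalgebra.counit (R := k) (A := C)).lTensor M (E.act M p x)) =
      op p • TensorProduct.rid k M ((Coalgebra.counit (R := k) (A := C)).lTensor M x) := by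
  induction x with
  | zero => simp only [map_zero, smul_zero]
  | add x y hx hy => simp only [map_add, smul_add, hx, hy]
  | tmul m c =>
    have h := LinearMap.congr_fun E.counit (c ⊗ₜ[k] p)
    simp only [LinearMap.comp_apply, LinearEquiv.coe_coe, LinearMap.rTensor_tmul,
      TensorProduct.lid_tmul] at h
    rw [E.act_tmul, rid_lTensor_counit_actTensor, h, LinearMap.lTensor_tmul,
      TensorProduct.rid_tmul, map_smul]
    exact ((rightAct k P M).map_smul₂ _ m p).symm

variable (M) in
omit [RightComodule k C P] [IsEntwinedModule E P] in
/-- The map `M ⊗ ε : M ⊗ C → M`. -/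
def counit : Cofree E M →ₗ[Pᵐᵒᵖ] M where
  toFun x := TensorProduct.rid k M ((Coalgebra.counit (R := k) (A := C)).lTensor M
    ((of E M).symm x))
  map_add' x y := by simp only [map_add]
  map_smul' p x := rid_lTensor_counit_act E p.unop x

omit [RightComodule k C P] [IsEntwinedModule E P] in
theorem counit_of_actTensor (m : M) (x : P ⊗[k] C) :
    counit M E (of E M (actTensor k P C M m x)) =
      rightAct k P M m (TensorProduct.rid k P
        ((Coalgebra.counit (R := k) (A := C)).lTensor P x)) :=
  rid_lTensor_counit_actTensor m x

omit [RightComodule k C P] [IsEntwinedModule E P] in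
theorem rTensor_counit_comul (x : M ⊗[k] C) :
    ((counit M E).restrictScalars k).rTensor C
      ((of E M).toLinearMap.rTensor C (comul C M x)) = x := by
  induction x with
  | zero => simp only [map_zero]
  | add x y hx hy => simp only [map_add, hx, hy]
  | tmul m c =>
    have h := congrArg (TensorProduct.lift ((LinearMap.lsmul k (M ⊗[k] C)).compl₂
      (TensorProduct.mk k M C m))) (Coalgebra.rTensor_counit_comul (R := k) c)
    rw [TensorProduct.lift.tmul] at h
    refine Eq.trans ?_ (h.trans (one_smul k (m ⊗ₜ[k] c)))
    rw [comul_tmul]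
    induction Coalgebra.comul (R := k) c with
    | zero => simp only [map_zero]
    | add x y hx hy => simp only [map_add, hx, hy]
    | tmul d e => exact TensorProduct.smul_tmul' _ _ _

/-- `M ≅ (M ⊗ C)^{co C}`, with inverse `M ⊗ ε`. -/
theorem unit_bijective : Function.Bijective (unit M E) := by
  refine ⟨fun m n h => ?_, fun ⟨x, hx⟩ => ?_⟩
  · have key (m : M) : counit M E (unit M E m : Cofree E M) = m := by
      refine (counit_of_actTensor E m _).trans ?_
      rw [RightComodule.lTensor_counit_coact]
      exact one_smul _ m
    rw [← key m, h, key n]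
  · refine ⟨counit M E x, Subtype.ext ?_⟩
    obtain ⟨x, rfl⟩ := (of E M).surjective x
    have hx' : RightComodule.coact (k := k) (C := C) (of E M x) =
      actTensor k P C (Cofree E M) (of E M x) (RightComodule.coact (k := k) (C := C) (1 : P)) := hx
    -- applying `M ⊗ ε ⊗ C` to `(M ⊗ Δ)(x) = x · Δ_P(1)` gives `x = (M ⊗ ε)(x) · Δ_P(1)`
    have h := congrArg (((counit M E).restrictScalars k).rTensor C) hx'
    rw [coact_of, rTensor_counit_comul, rTensor_actTensor] at h
    exact congrArg (of E M) h.symm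

variable (M) in
/-- The counit of adjunction at a cofree module is the canonical map. -/
theorem counitMap_map_unit (t : BalTensor k (coinvSubalgebra k C P) M P) :
    counitMap E (Cofree E M) (BalTensor.map k (coinvSubalgebra k C P) (unit M E) LinearMap.id t) =
      of E M (canMapCoeff k P C M t) := by
  induction t using BalTensor.induction_on with
  | zero => simp only [map_zero]
  | add x y hx hy => simp only [map_add, hx, hy]
  | mk m p => exact op_smul_of_actTensor_coact_one E m p

end Cofree

/-- The canonical map is the counit of adjunction at `P ⊗ C`. -/
theorem isCoalgebraGalois_of_bijective_counitMap
    (h : ∀ M : EntwinedModuleCat E, Function.Bijective (counitMap E M.carrier)) :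
    IsCoalgebraGalois k C P := by
  have h1 : Function.Bijective (canMapCoeff k P C P) := by
    have h2 : (Cofree.of E P).toLinearMap ∘ₗ canMapCoeff k P C P = counitMap E (Cofree E P) ∘ₗ
        BalTensor.map k (coinvSubalgebra k C P) (Cofree.unit P E) LinearMap.id :=
      LinearMap.ext fun t => (Cofree.counitMap_map_unit P E t).symm
    have h3 : Function.Bijective (counitMap E (Cofree E P) ∘
        BalTensor.map k (coinvSubalgebra k C P) (Cofree.unit P E)
          (LinearMap.id : P →ₗ[coinvSubalgebra k C P] P)) :=
      (h ⟨Cofree E P⟩).comp (BalTensor.map_bijective k _ (Cofree.unit_bijective E))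
    have h4 : Function.Bijective (Cofree.of E P ∘ canMapCoeff k P C P) := by
      have := congrArg DFunLike.coe h2
      simp only [LinearMap.coe_comp] at this
      exact this ▸ h3
    exact (Function.Bijective.of_comp_iff' (Cofree.of E P).bijective _).1 h4
  rwa [IsCoalgebraGalois, canMap_eq_canMapCoeff]

/-! ### Flat Galois extensions -/

/-- A right `P`-linear map, as a right `B`-linear map. -/
def LinearMap.toCoinv {N : Type u} [AddCommGroup N] [Module Pᵐᵒᵖ N] (f : M →ₗ[Pᵐᵒᵖ] N) :
    M →ₗ[(coinvSubalgebra k C P)ᵐᵒᵖ] N where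
  toFun := f
  map_add' := map_add f
  map_smul' b m := by
    obtain ⟨b, rfl⟩ := MulOpposite.op_surjective b
    exact map_smul f (op (b : P)) m

variable (M) [RightComodule k C M] [IsEntwinedModule E M]

/-- The coaction of `M`, as a map to the cofree module on `M`. -/
def Cofree.coactHom : M →ₗ[Pᵐᵒᵖ] Cofree E M where
  toFun m := of E M (RightComodule.coact m)
  map_add' m n := by simp only [map_add]
  map_smul' p m := congrArg (of E M) (IsEntwinedModule.coact_smul (E := E) m p.unop)

/-- The map `m ↦ ρ(m) - m · Δ_P(1)`, with kernel `M^{co C}`. -/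
def coinvDefect : M →ₗ[(coinvSubalgebra k C P)ᵐᵒᵖ] Cofree E M :=
  (Cofree.coactHom M E).toCoinv - (coinvariants E (Cofree E M)).subtype ∘ₗ Cofree.unit M E

theorem ker_coinvDefect : LinearMap.ker (coinvDefect M E) = coinvariants E M := by
  ext m
  rw [LinearMap.mem_ker, coinvDefect, LinearMap.sub_apply, sub_eq_zero]
  rfl

variable {M}

theorem canMapCoeff_map_coinvDefect (t : BalTensor k (coinvSubalgebra k C P) M P) :
    canMapCoeff k P C (Cofree E M)
        (BalTensor.map k (coinvSubalgebra k C P) (coinvDefect M E) LinearMap.id t) =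
      (Cofree.of E M).toLinearMap.rTensor C
        ((RightComodule.coact (k := k) (C := C) (M := M)).rTensor C (canMapCoeff k P C M t) -
          Cofree.comul C M (canMapCoeff k P C M t)) := by
  induction t using BalTensor.induction_on with
  | zero => simp only [map_zero, sub_zero]
  | add x y hx hy => simp only [map_add, hx, hy, map_sub]; abel
  | mk m p =>
    rw [BalTensor.map_mk, canMapCoeff_mk, canMapCoeff_mk, map_sub,
      ← Cofree.actTensor_of_actTensor_coact_one_coact, coinvDefect, LinearMap.sub_apply, map_sub,
      LinearMap.sub_apply]
    congr 1
    refine (rTensor_actTensor (Cofree.coactHom M E) m _).symm.trans ?_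
    exact LinearMap.rTensor_comp_apply C (Cofree.of E M).toLinearMap _ _

/-- Under the canonical maps, `σ_M` becomes the inclusion of `M^{co C} ⊗_B P` into `M ⊗_B P`. -/
theorem coact_counitMap (t : BalTensor k (coinvSubalgebra k C P) (coinvariants E M) P) :
    RightComodule.coact (k := k) (C := C) (counitMap E M t) = canMapCoeff k P C M
      (BalTensor.map k (coinvSubalgebra k C P) (coinvariants E M).subtype LinearMap.id t) := by
  induction t using BalTensor.induction_on with
  | zero => simp only [map_zero]
  | add x y hx hy => simp only [map_add, hx, hy]
  | mk m p => exact coact_op_smul_of_mem_coinvariants E m.2 p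

variable (M) in
/-- For a flat coalgebra-Galois extension, `M^{co C} ⊗_B P` is the kernel of
`M ⊗_B P → (M ⊗ C) ⊗_B P`, which by the canonical maps is the equalizer of `ρ ⊗ C` and `M ⊗ Δ`. -/
theorem IsCoalgebraGalois.bijective_counitMap (h : IsCoalgebraGalois k C P)
    (hflat : IsLeftFlat k (coinvSubalgebra k C P) P) : Function.Bijective (counitMap E M) := by
  refine ⟨fun s t hst => ?_, fun m => ?_⟩
  · apply hflat _ _ (coinvariants E M).subtype Subtype.val_injective
    apply (h.bijective_canMapCoeff M).1
    rw [← coact_counitMap, ← coact_counitMap, hst]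
  · obtain ⟨y, hy⟩ := (h.bijective_canMapCoeff M).2 (RightComodule.coact m)
    -- coassociativity says that `ρ ⊗ C` and `M ⊗ Δ` agree on `ρ(m)`
    have hy0 : BalTensor.map k (coinvSubalgebra k C P) (coinvDefect M E)
        (LinearMap.id : P →ₗ[coinvSubalgebra k C P] P) y = 0 := by
      apply (h.bijective_canMapCoeff (Cofree E M)).1
      rw [canMapCoeff_map_coinvDefect, hy, RightComodule.rTensor_coact_coact, map_zero]
      refine (congrArg _ (sub_self _)).trans (map_zero _)
    obtain ⟨z, hz⟩ := hflat.exists_map_subtype_ker hy0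
    have hk := (ker_coinvDefect M E).le
    refine ⟨BalTensor.map k (coinvSubalgebra k C P) (Submodule.inclusion hk) LinearMap.id z,
      RightComodule.coact_injective (k := k) (C := C) ?_⟩
    rw [coact_counitMap, ← BalTensor.map_comp, ← hy, ← hz]
    rfl

end

section

variable {k : Type v} [Field k] {P : Type u} [Ring P] [Algebra k P]
  {C : Type u} [AddCommGroup C] [Module k C] [Coalgebra k C] [RightComodule k C P]

/-! ### Induced entwined modules -/

section Induced

variable (N : Type u) [AddCommGroup N] [Module k N] [Module (coinvSubalgebra k C P)ᵐᵒᵖ N]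
  [IsScalarTower k (coinvSubalgebra k C P)ᵐᵒᵖ N]

variable (k C) in
/-- The map `n ⊗ p ↦ n ⊗ p r` on `N ⊗_B P`. -/
def BalTensor.inducedAct (r : P) :
    BalTensor k (coinvSubalgebra k C P) N P →ₗ[k] BalTensor k (coinvSubalgebra k C P) N P :=
  BalTensor.map k (coinvSubalgebra k C P) LinearMap.id
    (LinearMap.mulRight (coinvSubalgebra k C P) r)

variable {N}

theorem BalTensor.inducedAct_mk (r : P) (n : N) (p : P) :
    BalTensor.inducedAct k C N r (BalTensor.mk k (coinvSubalgebra k C P) N P n p) =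
      BalTensor.mk k (coinvSubalgebra k C P) N P n (p * r) := rfl

theorem BalTensor.inducedAct_one (t : BalTensor k (coinvSubalgebra k C P) N P) :
    BalTensor.inducedAct k C N (1 : P) t = t := by
  induction t using BalTensor.induction_on with
  | zero => exact map_zero _
  | add x y hx hy => rw [map_add, hx, hy]
  | mk n p => rw [inducedAct_mk, mul_one]

theorem BalTensor.inducedAct_mul (r s : P) (t : BalTensor k (coinvSubalgebra k C P) N P) :
    BalTensor.inducedAct k C N (r * s) t =
      BalTensor.inducedAct k C N s (BalTensor.inducedAct k C N r t) := by
  induction t using BalTensor.induction_on with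
  | zero => simp only [map_zero]
  | add x y hx hy => simp only [map_add, hx, hy]
  | mk n p => simp only [inducedAct_mk, mul_assoc]

theorem BalTensor.inducedAct_add (r s : P) (t : BalTensor k (coinvSubalgebra k C P) N P) :
    BalTensor.inducedAct k C N (r + s) t =
      BalTensor.inducedAct k C N r t + BalTensor.inducedAct k C N s t := by
  induction t using BalTensor.induction_on with
  | zero => simp only [map_zero, add_zero]
  | add x y hx hy => simp only [map_add, hx, hy]; abel
  | mk n p => simp only [inducedAct_mk, mul_add, map_add]

theorem BalTensor.inducedAct_smul (c : k) (r : P)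
    (t : BalTensor k (coinvSubalgebra k C P) N P) :
    BalTensor.inducedAct k C N (c • r) t = c • BalTensor.inducedAct k C N r t := by
  induction t using BalTensor.induction_on with
  | zero => simp only [map_zero, smul_zero]
  | add x y hx hy => simp only [map_add, hx, hy, smul_add]
  | mk n p => simp only [inducedAct_mk, mul_smul_comm, map_smul]

variable (N)

/-- The right `P`-action `(n ⊗ p) r = n ⊗ p r` on `N ⊗_B P`. -/
instance BalTensor.inducedModule : Module Pᵐᵒᵖ (BalTensor k (coinvSubalgebra k C P) N P) where
  smul r t := BalTensor.inducedAct k C N r.unop t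
  one_smul := BalTensor.inducedAct_one
  mul_smul r s := BalTensor.inducedAct_mul s.unop r.unop
  smul_zero r := map_zero _
  smul_add r := map_add _
  add_smul r s := BalTensor.inducedAct_add r.unop s.unop
  zero_smul t := by
    have h := BalTensor.inducedAct_smul 0 (0 : P) t
    rwa [zero_smul, zero_smul] at h

instance BalTensor.induced_isScalarTower :
    IsScalarTower k Pᵐᵒᵖ (BalTensor k (coinvSubalgebra k C P) N P) where
  smul_assoc c r := BalTensor.inducedAct_smul (C := C) (N := N) c r.unop

variable {N}

theorem BalTensor.op_smul_mk (n : N) (p r : P) :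
    op r • BalTensor.mk k (coinvSubalgebra k C P) N P n p =
      BalTensor.mk k (coinvSubalgebra k C P) N P n (p * r) := rfl

theorem BalTensor.map_op_smul {N' : Type u} [AddCommGroup N'] [Module k N']
    [Module (coinvSubalgebra k C P)ᵐᵒᵖ N'] [IsScalarTower k (coinvSubalgebra k C P)ᵐᵒᵖ N']
    (g : N →ₗ[(coinvSubalgebra k C P)ᵐᵒᵖ] N') (r : P)
    (t : BalTensor k (coinvSubalgebra k C P) N P) :
    BalTensor.map k (coinvSubalgebra k C P) g (LinearMap.id : P →ₗ[coinvSubalgebra k C P] P)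
        (op r • t) =
      op r • BalTensor.map k (coinvSubalgebra k C P) g
        (LinearMap.id : P →ₗ[coinvSubalgebra k C P] P) t := by
  induction t using BalTensor.induction_on with
  | zero => simp only [map_zero, smul_zero]
  | add x y hx hy => simp only [map_add, hx, hy, smul_add]
  | mk n p => rfl

/-- The `P`-linear map `P → N ⊗_B P`, `p ↦ n ⊗ p`. -/
def BalTensor.mkHom (n : N) :
    P →ₗ[Pᵐᵒᵖ] BalTensor k (coinvSubalgebra k C P) N P where
  toFun := BalTensor.mk k (coinvSubalgebra k C P) N P n
  map_add' := map_add _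
  map_smul' _ _ := rfl

variable (N)

/-- The coaction `N ⊗ Δ_P` on `N ⊗_B P`, written as `n ⊗ p ↦ n ⊗ Δ_P(p)`. -/
def BalTensor.inducedCoact : BalTensor k (coinvSubalgebra k C P) N P →ₗ[k]
    BalTensor k (coinvSubalgebra k C P) N P ⊗[k] C :=
  BalTensor.lift k (coinvSubalgebra k C P)
    ((LinearMap.rTensorHom C ∘ₗ BalTensor.mk k (coinvSubalgebra k C P) N P).compl₂
      RightComodule.coact)
    (by
      intro n b p
      change (BalTensor.mk k (coinvSubalgebra k C P) N P (op b • n)).rTensor C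
          (RightComodule.coact p) =
        (BalTensor.mk k (coinvSubalgebra k C P) N P n).rTensor C
          (RightComodule.coact ((b : P) * p))
      rw [b.2 p]
      induction RightComodule.coact (k := k) (C := C) p with
      | zero => simp
      | add x y hx hy => simp only [map_add, hx, hy, smul_add]
      | tmul q c =>
        exact congrArg (· ⊗ₜ[k] c) (BalTensor.mk_op_smul k (coinvSubalgebra k C P) n b q))

omit [IsScalarTower k (coinvSubalgebra k C P)ᵐᵒᵖ N] in
theorem BalTensor.span_mk : Submodule.span k {x : BalTensor k (coinvSubalgebra k C P) N P |
    ∃ n p, BalTensor.mk k (coinvSubalgebra k C P) N P n p = x} = ⊤ := by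
  refine Submodule.eq_top_iff'.2 fun t => ?_
  induction t using BalTensor.induction_on with
  | zero => exact zero_mem _
  | add x y hx hy => exact add_mem hx hy
  | mk n p => exact Submodule.subset_span ⟨n, p, rfl⟩

instance BalTensor.inducedComodule :
    RightComodule k C (BalTensor k (coinvSubalgebra k C P) N P) :=
  RightComodule.ofSpan (BalTensor.inducedCoact N) (BalTensor.mk k (coinvSubalgebra k C P) N P)
    (fun _ _ => rfl) (BalTensor.span_mk N)

instance BalTensor.induced_isEntwinedModule (E : Entwining k P C) [IsEntwinedModule E P] :
    IsEntwinedModule E (BalTensor k (coinvSubalgebra k C P) N P) :=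
  IsEntwinedModule.of_span E (M := P) (BalTensor.mkHom (N := N)) (fun _ _ => rfl)
    (BalTensor.span_mk N)

/-- The unit of adjunction `N → (N ⊗_B P)^{co C}`, `n ↦ n ⊗ 1`. -/
def BalTensor.inducedUnit (E : Entwining k P C) [IsEntwinedModule E P] :
    N →ₗ[(coinvSubalgebra k C P)ᵐᵒᵖ]
      coinvariants E (BalTensor k (coinvSubalgebra k C P) N P) where
  toFun n := ⟨BalTensor.mk k (coinvSubalgebra k C P) N P n 1, by
    have h := rTensor_actTensor (C := C) (BalTensor.mkHom (k := k) (C := C) (P := P) n) 1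
      (RightComodule.coact (k := k) (1 : P))
    rw [actTensor_eq_smul, one_smul] at h
    exact h⟩
  map_add' m n := Subtype.ext (by simp)
  map_smul' b n := Subtype.ext (by
    obtain ⟨b, rfl⟩ := MulOpposite.op_surjective b
    refine (BalTensor.mk_op_smul k (coinvSubalgebra k C P) n b 1).trans ?_
    change _ = BalTensor.mk k (coinvSubalgebra k C P) N P n (1 * (b : P))
    rw [one_mul]
    exact congrArg _ (mul_one (b : P)))

end Induced

/-! ### Full faithfulness of the coaction-invariants functor -/

variable (E : Entwining k P C) [IsEntwinedModule E P]

section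

variable {M : Type u} [AddCommGroup M] [Module k M] [Module Pᵐᵒᵖ M] [IsScalarTower k Pᵐᵒᵖ M]
  [RightComodule k C M] [IsEntwinedModule E M]

theorem counitMap_mk (m : coinvariants E M) (p : P) :
    counitMap E M (BalTensor.mk k (coinvSubalgebra k C P) (coinvariants E M) P m p) =
      op p • (m : M) := rfl

theorem counitMap_op_smul (r : P)
    (t : BalTensor k (coinvSubalgebra k C P) (coinvariants E M) P) :
    counitMap E M (op r • t) = op r • counitMap E M t := by
  induction t using BalTensor.induction_on with
  | zero => simp only [map_zero, smul_zero]
  | add x y hx hy => simp only [map_add, smul_add, hx, hy]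
  | mk m p => rw [BalTensor.op_smul_mk, counitMap_mk, counitMap_mk, smul_smul, MulOpposite.op_mul]

end

namespace EntwinedModuleCat

variable {E}

theorem Hom.map_counitMap {M N : EntwinedModuleCat E} (f : Hom M N)
    (t : BalTensor k (coinvSubalgebra k C P) (coinvariants E M.carrier) P) :
    f.toLinearMap (counitMap E M.carrier t) = counitMap E N.carrier
      (BalTensor.map k (coinvSubalgebra k C P) f.coinv LinearMap.id t) := by
  induction t using BalTensor.induction_on with
  | zero => simp only [map_zero]
  | add x y hx hy => simp only [map_add, hx, hy]
  | mk m p => exact map_smul f.toLinearMap (op p) m.1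

variable (M : EntwinedModuleCat E)

/-- The counit of adjunction as a morphism of entwined modules. -/
def counitHom : Hom ⟨BalTensor k (coinvSubalgebra k C P) (coinvariants E M.carrier) P⟩ M where
  toLinearMap :=
    { toFun := counitMap E M.carrier
      map_add' := map_add _
      map_smul' r t := counitMap_op_smul E r.unop t }
  colinear t := by
    induction t using BalTensor.induction_on with
    | zero => simp only [map_zero]
    | add x y hx hy => simp only [map_add, hx, hy]
    | mk m p =>
      exact (coact_op_smul_of_mem_coinvariants E m.2 p).trans
        (LinearMap.rTensor_comp_apply C (counitMap E M.carrier)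
          (BalTensor.mk k (coinvSubalgebra k C P) (coinvariants E M.carrier) P m) _)

variable {M}

/-- If the counits of adjunction are bijective, every `B`-linear map between coaction invariants
extends to a morphism of entwined modules. -/
theorem exists_coinv_eq {N : EntwinedModuleCat E} (hM : Function.Bijective (counitMap E M.carrier))
    (g : coinvariants E M.carrier →ₗ[(coinvSubalgebra k C P)ᵐᵒᵖ] coinvariants E N.carrier) :
    ∃ f : Hom M N, f.coinv = g := by
  let h : M.carrier →ₗ[k] N.carrier :=
    counitMap E N.carrier ∘ₗ BalTensor.map k (coinvSubalgebra k C P) g LinearMap.id ∘ₗ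
      (LinearEquiv.ofBijective _ hM).symm.toLinearMap
  have hh (t) : h (counitMap E M.carrier t) =
      counitMap E N.carrier (BalTensor.map k (coinvSubalgebra k C P) g LinearMap.id t) :=
    congrArg (fun s => counitMap E N.carrier
      (BalTensor.map k (coinvSubalgebra k C P) g LinearMap.id s))
      ((LinearEquiv.ofBijective _ hM).symm_apply_apply t)
  have hh' (m : coinvariants E M.carrier) (p : P) : h (op p • (m : M.carrier)) =
      op p • (g m : N.carrier) :=
    hh (BalTensor.mk k (coinvSubalgebra k C P) _ P m p)
  let f : M.carrier →ₗ[Pᵐᵒᵖ] N.carrier :=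
    { toFun := h
      map_add' := map_add h
      map_smul' r m := by
        obtain ⟨t, rfl⟩ := hM.2 m
        obtain ⟨r, rfl⟩ := MulOpposite.op_surjective r
        rw [← counitMap_op_smul, hh, RingHom.id_apply, hh, ← counitMap_op_smul,
          BalTensor.map_op_smul] }
  refine ⟨⟨f, fun m => ?_⟩, LinearMap.ext fun m => Subtype.ext ?_⟩
  · obtain ⟨t, rfl⟩ := hM.2 m
    change RightComodule.coact (h (counitMap E M.carrier t)) =
      h.rTensor C (RightComodule.coact (counitMap E M.carrier t))
    induction t using BalTensor.induction_on with
    | zero => simp only [map_zero]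
    | add x y hx hy => simp only [map_add, hx, hy]
    | mk m p =>
      have hm : h ∘ₗ rightAct k P M.carrier m = rightAct k P N.carrier (g m) :=
        LinearMap.ext (hh' m)
      rw [counitMap_mk, hh', coact_op_smul_of_mem_coinvariants E (g m).2,
        coact_op_smul_of_mem_coinvariants E m.2]
      change (rightAct k P N.carrier (g m)).rTensor C _ =
        h.rTensor C ((rightAct k P M.carrier m).rTensor C _)
      rw [← hm, LinearMap.rTensor_comp_apply]
  · have := hh' m 1
    rwa [MulOpposite.op_one, one_smul, one_smul] at this

theorem full_and_faithful_of_bijective_counitMap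
    (h : ∀ M : EntwinedModuleCat E, Function.Bijective (counitMap E M.carrier)) :
    (coinvFunctor E).Full ∧ (coinvFunctor E).Faithful := by
  refine ⟨⟨fun {M N} g => ?_⟩, ⟨fun {M N} f g hfg => ?_⟩⟩
  · obtain ⟨f, hf⟩ := exists_coinv_eq (h M) g.hom
    exact ⟨f, ModuleCat.hom_ext hf⟩
  · have hfg' : Hom.coinv f = Hom.coinv g := congrArg ModuleCat.Hom.hom hfg
    refine Hom.ext (LinearMap.ext fun m => ?_)
    obtain ⟨t, rfl⟩ := (h M).2 m
    rw [Hom.map_counitMap, Hom.map_counitMap, hfg']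

/-- Fullness extends the unit `M^{co C} → (M^{co C} ⊗_B P)^{co C}` to a morphism
`s : M → M^{co C} ⊗_B P`, which is inverse to the counit. -/
theorem bijective_counitMap_of_full_of_faithful (hfull : (coinvFunctor E).Full)
    (hfaithful : (coinvFunctor E).Faithful) (M : EntwinedModuleCat E) :
    Function.Bijective (counitMap E M.carrier) := by
  let I : EntwinedModuleCat E :=
    ⟨BalTensor k (coinvSubalgebra k C P) (coinvariants E M.carrier) P⟩
  obtain ⟨s, hs⟩ := (coinvFunctor E).map_surjective (X := M) (Y := I)
    (ModuleCat.ofHom (BalTensor.inducedUnit (coinvariants E M.carrier) E))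
  have hs' (m : coinvariants E M.carrier) : Hom.toLinearMap s (m : M.carrier) =
      BalTensor.mk k (coinvSubalgebra k C P) (coinvariants E M.carrier) P m 1 :=
    congrArg Subtype.val (LinearMap.congr_fun (congrArg ModuleCat.Hom.hom hs) m)
  -- by faithfulness, as both sides restrict to the identity of `M^{co C}`
  have hid : s ≫ (show I ⟶ M from counitHom M) = 𝟙 M := by
    apply (coinvFunctor E).map_injective
    refine ModuleCat.hom_ext (LinearMap.ext fun m => Subtype.ext ?_)
    change counitMap E M.carrier (Hom.toLinearMap s (m : coinvariants E M.carrier).1) = m.1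
    refine (congrArg (counitMap E M.carrier) (hs' m)).trans ?_
    exact one_smul Pᵐᵒᵖ m.1
  refine Function.bijective_iff_has_inverse.2 ⟨Hom.toLinearMap s, fun t => ?_, fun m => ?_⟩
  · induction t using BalTensor.induction_on with
    | zero => simp only [map_zero]
    | add x y hx hy => simp only [map_add, hx, hy]
    | mk m p => rw [counitMap_mk, map_smul, hs', BalTensor.op_smul_mk, one_mul]
  · exact congrArg (fun f => Hom.toLinearMap f m) hid

end EntwinedModuleCat

end

section

variable {k : Type v} [Field k] {P : Type u} [Ring P] [Algebra k P]
  {C : Type u} [AddCommGroup C] [Module k C] [Coalgebra k C]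

/-! ### Kernels of morphisms of entwined modules -/

namespace EntwinedModuleCat

variable {E : Entwining k P C} {M N : EntwinedModuleCat E} (f : Hom M N)

/-- The inclusion of the kernel of a morphism, as a `k`-linear map. -/
def Hom.kerSubtype : LinearMap.ker f.toLinearMap →ₗ[k] M.carrier :=
  (LinearMap.ker f.toLinearMap).subtype.restrictScalars k

theorem Hom.rTensor_kerSubtype_injective : Function.Injective (f.kerSubtype.rTensor C) :=
  Module.Flat.rTensor_preserves_injective_linearMap _ Subtype.val_injective

/-- The coaction of `M` maps `ker f` to `ker f ⊗ C`, which is the kernel of `f ⊗ C`. -/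
theorem Hom.coact_mem_range_rTensor_kerSubtype (m : LinearMap.ker f.toLinearMap) :
    RightComodule.coact (k := k) (C := C) (f.kerSubtype m) ∈
      LinearMap.range (f.kerSubtype.rTensor C) := by
  have hex : Function.Exact f.kerSubtype (f.toLinearMap.restrictScalars k) :=
    fun m => by simp [kerSubtype]
  refine (Module.Flat.rTensor_exact C hex _).1 ?_
  have hm : f.toLinearMap m.1 = 0 := m.2
  refine (f.colinear m.1).symm.trans ?_
  rw [hm, map_zero]

/-- The coaction of `M` restricted to `ker f`. -/
def Hom.kerCoact : LinearMap.ker f.toLinearMap →ₗ[k] LinearMap.ker f.toLinearMap ⊗[k] C :=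
  LinearMap.codRestrictOfInjective
    (RightComodule.coact (k := k) (C := C) ∘ₗ f.kerSubtype) (f.kerSubtype.rTensor C)
    f.rTensor_kerSubtype_injective f.coact_mem_range_rTensor_kerSubtype

theorem Hom.coact_kerSubtype (m : LinearMap.ker f.toLinearMap) :
    RightComodule.coact (k := k) (C := C) (f.kerSubtype m) =
      f.kerSubtype.rTensor C (f.kerCoact m) :=
  (LinearMap.codRestrictOfInjective_comp_apply
    (RightComodule.coact (k := k) (C := C) ∘ₗ f.kerSubtype) (f.kerSubtype.rTensor C)
    f.rTensor_kerSubtype_injective f.coact_mem_range_rTensor_kerSubtype m).symm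

instance Hom.kerComodule : RightComodule k C (LinearMap.ker f.toLinearMap) :=
  RightComodule.ofInjective f.kerCoact f.kerSubtype f.coact_kerSubtype Subtype.val_injective

instance Hom.ker_isEntwinedModule : IsEntwinedModule E (LinearMap.ker f.toLinearMap) :=
  IsEntwinedModule.of_injective E (LinearMap.ker f.toLinearMap).subtype f.coact_kerSubtype
    Subtype.val_injective

/-- The kernel of a morphism, as an entwined module. -/
def Hom.kernel : EntwinedModuleCat E := ⟨LinearMap.ker f.toLinearMap⟩

/-- The inclusion of the kernel, as a morphism of entwined modules. -/
def Hom.kernelι : Hom f.kernel M := ⟨(LinearMap.ker f.toLinearMap).subtype, f.coact_kerSubtype⟩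

end EntwinedModuleCat

/-! ### Multiples of the entwined module `P` -/

variable [RightComodule k C P] (V : Type u) [AddCommGroup V] [Module k V]

/-- The coaction on the multiple `P ⊗ V` of the comodule `P`. -/
def tensorCoact : P ⊗[k] V →ₗ[k] (P ⊗[k] V) ⊗[k] C :=
  (TensorProduct.rightComm k P C V).toLinearMap ∘ₗ
    (RightComodule.coact (k := k) (C := C) (M := P)).rTensor V

variable {V}

/-- The `P`-linear map `P → P ⊗ V`, `p ↦ p ⊗ v`. -/
def tensorMkHom (v : V) : P →ₗ[Pᵐᵒᵖ] P ⊗[k] V where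
  toFun p := p ⊗ₜ[k] v
  map_add' p q := TensorProduct.add_tmul p q v
  map_smul' _ _ := rfl

theorem tensorCoact_tmul (p : P) (v : V) : tensorCoact (C := C) V (p ⊗ₜ[k] v) =
    ((tensorMkHom (k := k) v).restrictScalars k).rTensor C (RightComodule.coact p) := by
  rw [tensorCoact, LinearMap.comp_apply, LinearMap.rTensor_tmul]
  induction RightComodule.coact (k := k) (C := C) p with
  | zero => simp
  | add x y hx hy => simp only [TensorProduct.add_tmul, map_add, hx, hy]
  | tmul q c => rfl

variable (V)

theorem span_tensorMkHom :
    Submodule.span k {x : P ⊗[k] V | ∃ v p, tensorMkHom (k := k) v p = x} = ⊤ := by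
  refine Submodule.eq_top_iff'.2 fun x => ?_
  induction x with
  | zero => exact zero_mem _
  | add x y hx hy => exact add_mem hx hy
  | tmul p v => exact Submodule.subset_span ⟨v, p, rfl⟩

instance tensorComodule : RightComodule k C (P ⊗[k] V) :=
  RightComodule.ofSpan (tensorCoact V)
    (fun v : V => (tensorMkHom (k := k) (P := P) v).restrictScalars k)
    (fun v p => tensorCoact_tmul p v) (span_tensorMkHom V)

instance tensor_isEntwinedModule (E : Entwining k P C) [IsEntwinedModule E P] :
    IsEntwinedModule E (P ⊗[k] V) :=
  IsEntwinedModule.of_span E (tensorMkHom (k := k) (P := P) (V := V))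
    (fun v p => tensorCoact_tmul p v) (span_tensorMkHom V)

variable {V}

theorem coact_tmul (p : P) (v : V) : RightComodule.coact (k := k) (C := C) (p ⊗ₜ[k] v) =
    ((tensorMkHom (k := k) v).restrictScalars k).rTensor C (RightComodule.coact p) :=
  tensorCoact_tmul p v

omit [RightComodule k C P] [Coalgebra k C] in
theorem actTensor_tmul_left (p : P) (v : V) (y : P ⊗[k] C) :
    actTensor k P C (P ⊗[k] V) (p ⊗ₜ[k] v) y =
      ((tensorMkHom (k := k) v).restrictScalars k).rTensor C (p • y) := by
  rw [← actTensor_eq_smul, rTensor_actTensor]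
  rfl

variable (E : Entwining k P C) [IsEntwinedModule E P]

variable (k C P V) in
/-- The inclusion of `B ⊗ V` in `P ⊗ V`. -/
def coinvTensorIncl : coinvSubalgebra k C P ⊗[k] V →ₗ[k] P ⊗[k] V :=
  (coinvSubalgebra k C P).val.toLinearMap.rTensor V

variable (V) in
/-- The map from `B ⊗ V` to the coaction invariants of `P ⊗ V`. -/
def coinvTensor : coinvSubalgebra k C P ⊗[k] V →ₗ[(coinvSubalgebra k C P)ᵐᵒᵖ]
    coinvariants E (P ⊗[k] V) where
  toFun z := ⟨coinvTensorIncl k P C V z, by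
    induction z with
    | zero => rw [map_zero]; exact zero_mem _
    | add x y hx hy => rw [map_add]; exact add_mem hx hy
    | tmul b v =>
      change RightComodule.coact (k := k) (C := C) ((b : P) ⊗ₜ[k] v) =
        actTensor k P C (P ⊗[k] V) ((b : P) ⊗ₜ[k] v) (RightComodule.coact (1 : P))
      rw [coact_tmul, actTensor_tmul_left, ← coact_coinv]⟩
  map_add' x y := Subtype.ext (map_add _ x y)
  map_smul' b z := Subtype.ext (by
    obtain ⟨b, rfl⟩ := MulOpposite.op_surjective b
    change coinvTensorIncl k P C V (op b • z) = op (b : P) • coinvTensorIncl k P C V z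
    induction z with
    | zero => simp only [smul_zero, map_zero]
    | add x y hx hy => simp only [smul_add, map_add, hx, hy]
    | tmul b' v => rfl)

theorem coinvTensor_bijective : Function.Bijective (coinvTensor V E) := by
  refine ⟨fun x y h => ?_, fun ⟨x, hx⟩ => ?_⟩
  · exact Module.Flat.rTensor_preserves_injective_linearMap (M := V)
      (coinvSubalgebra k C P).val.toLinearMap Subtype.val_injective (congrArg Subtype.val h)
  · let d : P →ₗ[k] P ⊗[k] C := RightComodule.coact (k := k) (C := C) -
      (actTensor k P C P).flip (RightComodule.coact (1 : P))
    have hd : Function.Exact (coinvSubalgebra k C P).val.toLinearMap d := fun p => by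
      have h1 : d p = RightComodule.coact (k := k) (C := C) p -
          p • RightComodule.coact (k := k) (C := C) (1 : P) := by
        rw [← actTensor_eq_smul]; rfl
      rw [h1, sub_eq_zero, ← mem_coinvSubalgebra_iff E]
      simp
    have hact (x : P ⊗[k] V) : TensorProduct.rightComm k P C V
        (((actTensor k P C P).flip (RightComodule.coact (1 : P))).rTensor V x) =
          actTensor k P C (P ⊗[k] V) x (RightComodule.coact (1 : P)) := by
      induction x with
      | zero => simp only [map_zero, LinearMap.zero_apply]
      | add x y hx hy => simp only [map_add, hx, hy, LinearMap.add_apply]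
      | tmul p v =>
        rw [actTensor_tmul_left, LinearMap.rTensor_tmul, LinearMap.flip_apply, actTensor_eq_smul]
        induction p • RightComodule.coact (k := k) (C := C) (1 : P) with
        | zero => simp
        | add x y hx hy => simp only [TensorProduct.add_tmul, map_add, hx, hy]
        | tmul q c => rfl
    have hx0 : d.rTensor V x = 0 := by
      apply (TensorProduct.rightComm k P C V).injective
      rw [LinearMap.rTensor_sub, map_zero]
      change TensorProduct.rightComm k P C V
        ((RightComodule.coact (k := k) (C := C) (M := P)).rTensor V x -
          ((actTensor k P C P).flip (RightComodule.coact (1 : P))).rTensor V x) = 0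
      rw [map_sub, hact, sub_eq_zero]
      exact hx
    obtain ⟨z, hz⟩ := (Module.Flat.rTensor_exact V hd x).1 hx0
    exact ⟨z, Subtype.ext hz⟩

end

/-! ### Flatness of generators -/

section

variable {k : Type v} [Field k] {P : Type u} [Ring P] [Algebra k P]
  {C : Type u} [AddCommGroup C] [Module k C] [Coalgebra k C] [RightComodule k C P]

section

variable (F : Type u) [AddCommGroup F] [Module k F] [Module (coinvSubalgebra k C P)ᵐᵒᵖ F]
  [IsScalarTower k (coinvSubalgebra k C P)ᵐᵒᵖ F]

variable (k C P) in
/-- The projection `P ⊗ F → F ⊗_B P`, `p ⊗ f ↦ f ⊗ p`. -/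
def toBal : P ⊗[k] F →ₗ[k] BalTensor k (coinvSubalgebra k C P) F P :=
  (balancedRelations k (coinvSubalgebra k C P) F P).mkQ ∘ₗ (TensorProduct.comm k P F).toLinearMap

variable {F}

omit [IsScalarTower k (coinvSubalgebra k C P)ᵐᵒᵖ F] in
theorem toBal_surjective : Function.Surjective (toBal k P C F) :=
  (Submodule.mkQ_surjective _).comp (TensorProduct.comm k P F).surjective

omit [IsScalarTower k (coinvSubalgebra k C P)ᵐᵒᵖ F] in
theorem toBal_eq_zero_iff (x : P ⊗[k] F) : toBal k P C F x = 0 ↔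
    TensorProduct.comm k P F x ∈ balancedRelations k (coinvSubalgebra k C P) F P :=
  Submodule.Quotient.mk_eq_zero _

theorem toBal_op_smul (p : P) (x : P ⊗[k] F) :
    toBal k P C F (op p • x) = op p • toBal k P C F x := by
  induction x with
  | zero => simp only [smul_zero, map_zero]
  | add x y hx hy => simp only [smul_add, map_add, hx, hy]
  | tmul q f => rfl

variable (k P C F) in
/-- The action `B ⊗ F → F`, `b ⊗ f ↦ f b`. -/
def coinvAct : coinvSubalgebra k C P ⊗[k] F →ₗ[(coinvSubalgebra k C P)ᵐᵒᵖ] F where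
  toFun := TensorProduct.lift (rightAct k (coinvSubalgebra k C P) F).flip
  map_add' := map_add _
  map_smul' b z := by
    obtain ⟨b, rfl⟩ := MulOpposite.op_surjective b
    induction z with
    | zero => simp only [smul_zero, map_zero]
    | add x y hx hy => simp only [smul_add, map_add, hx, hy]
    | tmul b' f =>
      change op (b' * b) • f = op b • (op b' • f)
      rw [smul_smul, MulOpposite.op_mul]

theorem toBal_coinvTensorIncl (z : coinvSubalgebra k C P ⊗[k] F) :
    toBal k P C F (coinvTensorIncl k P C F z) =
      BalTensor.mk k (coinvSubalgebra k C P) F P (coinvAct k P C F z) 1 := by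
  induction z with
  | zero => simp only [map_zero, LinearMap.zero_apply]
  | add x y hx hy => simp only [map_add, hx, hy, LinearMap.add_apply]
  | tmul b f =>
    refine Eq.trans ?_ (BalTensor.mk_op_smul k (coinvSubalgebra k C P) f b (1 : P)).symm
    change BalTensor.mk k (coinvSubalgebra k C P) F P f b =
      BalTensor.mk k (coinvSubalgebra k C P) F P f ((b : P) * 1)
    rw [mul_one]

end

variable {E : Entwining k P C} [IsEntwinedModule E P]

open EntwinedModuleCat

/-- The map `P ⊗ F → X`, `p ⊗ f ↦ i(f) p`, attached to a linear map `i : F → X`. -/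
def tensorLift {X F : Type u} [AddCommGroup X] [Module k X] [Module Pᵐᵒᵖ X]
    [IsScalarTower k Pᵐᵒᵖ X] [AddCommGroup F] [Module k F] (i : F →ₗ[k] X) :
    P ⊗[k] F →ₗ[Pᵐᵒᵖ] X where
  toFun := TensorProduct.lift ((rightAct k P X).flip.compl₂ i)
  map_add' := map_add _
  map_smul' p x := by
    obtain ⟨p, rfl⟩ := MulOpposite.op_surjective p
    induction x with
    | zero => simp only [smul_zero, map_zero]
    | add x y hx hy => simp only [smul_add, map_add, hx, hy]
    | tmul q f =>
      change op (q * p) • i f = op p • (op q • i f)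
      rw [smul_smul, MulOpposite.op_mul]

theorem coact_tensorLift (E : Entwining k P C) [IsEntwinedModule E P] {X F : Type u}
    [AddCommGroup X] [Module k X] [Module Pᵐᵒᵖ X] [IsScalarTower k Pᵐᵒᵖ X] [RightComodule k C X]
    [IsEntwinedModule E X] [AddCommGroup F] [Module k F] {i : F →ₗ[k] X}
    (hi : ∀ f, i f ∈ coinvariants E X) (x : P ⊗[k] F) :
    RightComodule.coact (k := k) (C := C) (tensorLift (P := P) i x) =
      ((tensorLift (P := P) i).restrictScalars k).rTensor C (RightComodule.coact x) := by
  induction x with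
  | zero => simp only [map_zero]
  | add x y hx hy => simp only [map_add, hx, hy]
  | tmul p f =>
    refine (coact_op_smul_of_mem_coinvariants E (hi f) p).trans ?_
    rw [coact_tmul, ← LinearMap.rTensor_comp_apply]
    rfl

/-- The morphism of entwined modules `P ⊗ F → X`, `p ⊗ f ↦ i(f) p`, attached to a linear map
`i : F → X^{co C}`. -/
def tensorHom (X : EntwinedModuleCat E) {F : Type u} [AddCommGroup F] [Module k F]
    (i : F →ₗ[k] X.carrier) (hi : ∀ f, i f ∈ coinvariants E X.carrier) :
    Hom ⟨P ⊗[k] F⟩ X :=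
  ⟨tensorLift i, coact_tensorLift E hi⟩

/-- If all counits of adjunction are bijective, then `F ⊗_B P → X` is injective for every
`B`-submodule `F` of `X^{co C}`. The kernel of `P ⊗ F → X` is generated by its coaction invariants;
these lie in `(P ⊗ F)^{co C} = B ⊗ F`, so that they vanish in `F ⊗_B P` if they vanish in `X`. -/
theorem injective_counitMap_map
    (h : ∀ M : EntwinedModuleCat E, Function.Bijective (counitMap E M.carrier))
    (X : Type u) [AddCommGroup X] [Module k X] [Module Pᵐᵒᵖ X] [IsScalarTower k Pᵐᵒᵖ X]
    [RightComodule k C X] [IsEntwinedModule E X] {F : Type u} [AddCommGroup F] [Module k F]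
    [Module (coinvSubalgebra k C P)ᵐᵒᵖ F] [IsScalarTower k (coinvSubalgebra k C P)ᵐᵒᵖ F]
    (i : F →ₗ[(coinvSubalgebra k C P)ᵐᵒᵖ] coinvariants E X) (hi : Function.Injective i) :
    Function.Injective (counitMap E X ∘ₗ BalTensor.map k (coinvSubalgebra k C P) i
      (LinearMap.id : P →ₗ[coinvSubalgebra k C P] P)) := by
  let i' : F →ₗ[k] X :=
    (coinvariants E X).subtype.restrictScalars k ∘ₗ i.restrictScalars k
  let Φ := tensorHom ⟨X⟩ i' (fun f => (i f).2)
  have hΦ (x : P ⊗[k] F) : Φ.toLinearMap x = counitMap E X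
      (BalTensor.map k (coinvSubalgebra k C P) i LinearMap.id (toBal k P C F x)) := by
    induction x with
    | zero => simp only [map_zero]
    | add x y hx hy => simp only [map_add, hx, hy]
    | tmul p f => rfl
  let j : Φ.kernel.carrier →ₗ[Pᵐᵒᵖ] P ⊗[k] F := Φ.kernelι.toLinearMap
  have hker (κ : coinvariants E Φ.kernel.carrier) : toBal k P C F (j κ) = 0 := by
    obtain ⟨z, hz⟩ := (coinvTensor_bijective E).2 (Φ.kernelι.coinv κ)
    have hz' : coinvTensorIncl k P C F z = j κ := congrArg Subtype.val hz
    have h0 : Φ.toLinearMap (j κ) = 0 := (show LinearMap.ker Φ.toLinearMap from κ.1).2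
    rw [← hz', hΦ, toBal_coinvTensorIncl, BalTensor.map_mk, counitMap_mk] at h0
    have h1 : ((i (coinvAct k P C F z) : coinvariants E X) : X) = 0 :=
      (one_smul Pᵐᵒᵖ _).symm.trans h0
    have h2 : coinvAct k P C F z = 0 :=
      hi ((Subtype.ext h1).trans (map_zero i).symm)
    rw [← hz', toBal_coinvTensorIncl, h2, map_zero, LinearMap.zero_apply]
  have hker' (s : BalTensor k (coinvSubalgebra k C P) (coinvariants E Φ.kernel.carrier) P) :
      toBal k P C F (j (counitMap E Φ.kernel.carrier s)) = 0 := by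
    induction s using BalTensor.induction_on with
    | zero => simp only [map_zero]
    | add x y hx hy => simp only [map_add, hx, hy, add_zero]
    | mk κ p => rw [counitMap_mk, map_smul, toBal_op_smul, hker, smul_zero]
  refine (injective_iff_map_eq_zero _).2 fun t ht => ?_
  obtain ⟨x, rfl⟩ := toBal_surjective t
  obtain ⟨s, hs⟩ := (h Φ.kernel).2 (show LinearMap.ker Φ.toLinearMap from ⟨x, (hΦ x).trans ht⟩)
  have h0 := hker' s
  rwa [hs] at h0

section

variable {N N' : Type u} [AddCommGroup N] [Module k N] [Module (coinvSubalgebra k C P)ᵐᵒᵖ N]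
  [IsScalarTower k (coinvSubalgebra k C P)ᵐᵒᵖ N]
  [AddCommGroup N'] [Module k N'] [Module (coinvSubalgebra k C P)ᵐᵒᵖ N']
  [IsScalarTower k (coinvSubalgebra k C P)ᵐᵒᵖ N']

/-- The pullback of `f : N → N'` along the free presentation `B ⊗ N' → N'`. -/
def freePullback (f : N →ₗ[(coinvSubalgebra k C P)ᵐᵒᵖ] N') :
    Submodule (coinvSubalgebra k C P)ᵐᵒᵖ ((coinvSubalgebra k C P ⊗[k] N') × N) :=
  LinearMap.ker (coinvAct k P C N' ∘ₗ LinearMap.fst _ _ _ - f ∘ₗ LinearMap.snd _ _ _)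

omit [Module k N] [IsScalarTower k (coinvSubalgebra k C P)ᵐᵒᵖ N] in
theorem mem_freePullback {f : N →ₗ[(coinvSubalgebra k C P)ᵐᵒᵖ] N'}
    {x : (coinvSubalgebra k C P ⊗[k] N') × N} :
    x ∈ freePullback f ↔ coinvAct k P C N' x.1 = f x.2 := by
  rw [freePullback, LinearMap.mem_ker, LinearMap.sub_apply, sub_eq_zero]
  rfl

/-- The map from the pullback to the coaction invariants of `P ⊗ N'`. -/
def freePullbackToCoinv (E : Entwining k P C) [IsEntwinedModule E P]
    (f : N →ₗ[(coinvSubalgebra k C P)ᵐᵒᵖ] N') :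
    freePullback f →ₗ[(coinvSubalgebra k C P)ᵐᵒᵖ] coinvariants E (P ⊗[k] N') :=
  coinvTensor N' E ∘ₗ LinearMap.fst _ _ _ ∘ₗ (freePullback f).subtype

omit [Module k N] [IsScalarTower k (coinvSubalgebra k C P)ᵐᵒᵖ N] in
theorem freePullbackToCoinv_injective {f : N →ₗ[(coinvSubalgebra k C P)ᵐᵒᵖ] N'}
    (hf : Function.Injective f) : Function.Injective (freePullbackToCoinv E f) := by
  rintro ⟨⟨z, n⟩, hz⟩ ⟨⟨z', n'⟩, hz'⟩ hzz
  obtain rfl : z = z' := (coinvTensor_bijective E).1 hzz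
  obtain rfl : n = n' := hf ((mem_freePullback.1 hz).symm.trans (mem_freePullback.1 hz'))
  rfl

/-- The projection from the pullback to `N`. -/
def freePullbackSnd (f : N →ₗ[(coinvSubalgebra k C P)ᵐᵒᵖ] N') :
    freePullback f →ₗ[(coinvSubalgebra k C P)ᵐᵒᵖ] N :=
  LinearMap.snd _ _ _ ∘ₗ (freePullback f).subtype

omit [Module k N] [IsScalarTower k (coinvSubalgebra k C P)ᵐᵒᵖ N] in
theorem freePullbackSnd_surjective (f : N →ₗ[(coinvSubalgebra k C P)ᵐᵒᵖ] N') :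
    Function.Surjective (freePullbackSnd f) := fun n =>
  ⟨⟨((1 : coinvSubalgebra k C P) ⊗ₜ[k] f n, n), mem_freePullback.2 (one_smul _ _)⟩, rfl⟩

/-- The square formed by the maps from `F ⊗_B P`, with `F` the pullback, to `P ⊗ N'` and `N ⊗_B P`
and by the maps from these to `N' ⊗_B P` commutes. -/
theorem toBal_counitMap_freePullback (f : N →ₗ[(coinvSubalgebra k C P)ᵐᵒᵖ] N')
    (t : BalTensor k (coinvSubalgebra k C P) (freePullback f) P) :
    toBal k P C N' (counitMap E (P ⊗[k] N')
        (BalTensor.map k (coinvSubalgebra k C P) (freePullbackToCoinv E f) LinearMap.id t)) =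
      BalTensor.map k (coinvSubalgebra k C P) f LinearMap.id
        (BalTensor.map k (coinvSubalgebra k C P) (freePullbackSnd f) LinearMap.id t) := by
  induction t using BalTensor.induction_on with
  | zero => simp only [map_zero]
  | add x y hx hy => simp only [map_add, hx, hy]
  | mk x p =>
    have hx : coinvAct k P C N' x.1.1 = f x.1.2 := mem_freePullback.1 x.2
    rw [BalTensor.map_mk, BalTensor.map_mk, BalTensor.map_mk, counitMap_mk, toBal_op_smul]
    have h1 : ((freePullbackToCoinv E f x : coinvariants E (P ⊗[k] N')) : P ⊗[k] N') =
      coinvTensorIncl k P C N' x.1.1 := rfl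
    rw [h1, toBal_coinvTensorIncl, hx, BalTensor.op_smul_mk]
    exact congrArg _ (one_mul p)

/-- The relations defining `N' ⊗_B P` come from elements of `F ⊗_B P`, with `F` the pullback, which
vanish in `N ⊗_B P`. -/
theorem exists_freePullback_of_mem_balancedRelations (E : Entwining k P C) [IsEntwinedModule E P]
    (f : N →ₗ[(coinvSubalgebra k C P)ᵐᵒᵖ] N')
    {w : N' ⊗[k] P} (hw : w ∈ balancedRelations k (coinvSubalgebra k C P) N' P) :
    ∃ r : BalTensor k (coinvSubalgebra k C P) (freePullback f) P,
      counitMap E (P ⊗[k] N') (BalTensor.map k (coinvSubalgebra k C P) (freePullbackToCoinv E f)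
        LinearMap.id r) = TensorProduct.comm k N' P w ∧
      BalTensor.map k (coinvSubalgebra k C P) (freePullbackSnd f)
        (LinearMap.id : P →ₗ[coinvSubalgebra k C P] P) r = 0 := by
  induction hw using Submodule.span_induction with
  | mem w hw =>
    obtain ⟨n, b, p, rfl⟩ := hw
    refine ⟨BalTensor.mk k (coinvSubalgebra k C P) (freePullback f) P
      ⟨((1 : coinvSubalgebra k C P) ⊗ₜ[k] (op b • n) - b ⊗ₜ[k] n, 0), mem_freePullback.2 ?_⟩ p,
      ?_, ?_⟩
    · rw [map_sub, map_zero]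
      exact sub_eq_zero.2 (one_smul _ _)
    · rw [BalTensor.map_mk, counitMap_mk]
      change op p • coinvTensorIncl k P C N'
        ((1 : coinvSubalgebra k C P) ⊗ₜ[k] (op b • n) - b ⊗ₜ[k] n) = _
      rw [map_sub, smul_sub, map_sub]
      change (((1 : coinvSubalgebra k C P) : P) * p) ⊗ₜ[k] (op b • n) - ((b : P) * p) ⊗ₜ[k] n =
        p ⊗ₜ[k] (op b • n) - ((b : P) * p) ⊗ₜ[k] n
      rw [OneMemClass.coe_one, one_mul]
    · rw [BalTensor.map_mk]
      change BalTensor.mk k (coinvSubalgebra k C P) N P 0 p = 0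
      rw [map_zero, LinearMap.zero_apply]
  | zero => exact ⟨0, by simp only [map_zero], map_zero _⟩
  | add x y _ _ hx hy =>
    obtain ⟨r, hr, hr'⟩ := hx
    obtain ⟨s, hs, hs'⟩ := hy
    exact ⟨r + s, by simp only [map_add, hr, hs], by rw [map_add, hr', hs', add_zero]⟩
  | smul c x _ hx =>
    obtain ⟨r, hr, hr'⟩ := hx
    exact ⟨c • r, by simp only [map_smul, hr], by rw [map_smul, hr', smul_zero]⟩

theorem exists_freePullback_of_toBal_eq_zero (E : Entwining k P C) [IsEntwinedModule E P]
    (f : N →ₗ[(coinvSubalgebra k C P)ᵐᵒᵖ] N') {x : P ⊗[k] N'} (hx : toBal k P C N' x = 0) :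
    ∃ r : BalTensor k (coinvSubalgebra k C P) (freePullback f) P,
      counitMap E (P ⊗[k] N') (BalTensor.map k (coinvSubalgebra k C P) (freePullbackToCoinv E f)
        LinearMap.id r) = x ∧
      BalTensor.map k (coinvSubalgebra k C P) (freePullbackSnd f)
        (LinearMap.id : P →ₗ[coinvSubalgebra k C P] P) r = 0 := by
  obtain ⟨r, hr, hr'⟩ := exists_freePullback_of_mem_balancedRelations E f
    ((toBal_eq_zero_iff x).1 hx)
  exact ⟨r, hr.trans ((TensorProduct.comm k P N').symm_apply_apply x), hr'⟩

theorem map_freePullbackSnd_surjective (f : N →ₗ[(coinvSubalgebra k C P)ᵐᵒᵖ] N') :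
    Function.Surjective (BalTensor.map k (coinvSubalgebra k C P) (M := freePullback f)
      (freePullbackSnd f) (LinearMap.id : P →ₗ[coinvSubalgebra k C P] P)) :=
  BalTensor.map_surjective k _ (M := freePullback f) (freePullbackSnd_surjective f)

/-- If all counits of adjunction are bijective, `- ⊗_B P` preserves injectivity: an element of
`F ⊗_B P`, with `F` the pullback of `f`, which dies in `N' ⊗_B P` has the same image in `P ⊗ N'` as
an element which dies in `N ⊗_B P`, and both agree by injectivity of `F ⊗_B P → P ⊗ N'`. -/
theorem map_eq_zero_of_bijective_counitMap
    (h : ∀ M : EntwinedModuleCat E, Function.Bijective (counitMap E M.carrier))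
    {f : N →ₗ[(coinvSubalgebra k C P)ᵐᵒᵖ] N'} (hf : Function.Injective f)
    {t : BalTensor k (coinvSubalgebra k C P) (freePullback f) P}
    (ht : BalTensor.map k (coinvSubalgebra k C P) f LinearMap.id
      (BalTensor.map k (coinvSubalgebra k C P) (freePullbackSnd f)
        (LinearMap.id : P →ₗ[coinvSubalgebra k C P] P) t) = 0) :
    BalTensor.map k (coinvSubalgebra k C P) (freePullbackSnd f)
      (LinearMap.id : P →ₗ[coinvSubalgebra k C P] P) t = 0 := by
  obtain ⟨r, hr, hr'⟩ := exists_freePullback_of_toBal_eq_zero E f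
    ((toBal_counitMap_freePullback (E := E) f t).trans ht)
  have hrt : r = t := injective_counitMap_map h (P ⊗[k] N') (freePullbackToCoinv E f)
    (freePullbackToCoinv_injective hf) hr
  rw [← hrt, hr']

end

theorem isLeftFlat_of_bijective_counitMap
    (h : ∀ M : EntwinedModuleCat E, Function.Bijective (counitMap E M.carrier)) :
    IsLeftFlat k (coinvSubalgebra k C P) P := by
  intro N N' _ _ _ _ _ _ _ _ f hf
  refine (injective_iff_map_eq_zero _).2 fun y hy => ?_
  obtain ⟨t, rfl⟩ := map_freePullbackSnd_surjective f y
  exact map_eq_zero_of_bijective_counitMap h hf hy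

end

end

theorem theorem2 {k : Type v} [Field k] {P : Type u} [Ring P] [Algebra k P]
    {C : Type u} [AddCommGroup C] [Module k C] [Coalgebra k C]
    (E : Entwining k P C) [RightComodule k C P] [IsEntwinedModule E P] :
    List.TFAE [
      (∃ h : IsCoalgebraGalois k C P, IsCanonicalEntwining h E) ∧
        IsLeftFlat k (coinvSubalgebra k C P) P,
      (EntwinedModuleCat.coinvFunctor E).Full ∧ (EntwinedModuleCat.coinvFunctor E).Faithful,
      ∀ M : EntwinedModuleCat E, Function.Bijective (counitMap E M.carrier)] := by
  tfae_have 1 → 3 := fun ⟨⟨h, _⟩, hflat⟩ M => h.bijective_counitMap M.carrier E hflat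
  tfae_have 3 → 2 := EntwinedModuleCat.full_and_faithful_of_bijective_counitMap
  tfae_have 2 → 3 := fun ⟨hfull, hfaithful⟩ =>
    EntwinedModuleCat.bijective_counitMap_of_full_of_faithful hfull hfaithful
  tfae_have 3 → 1 := fun h =>
    ⟨⟨isCoalgebraGalois_of_bijective_counitMap E h,
      (isCoalgebraGalois_of_bijective_counitMap E h).isCanonicalEntwining E⟩,
      isLeftFlat_of_bijective_counitMap h⟩
  tfae_finish
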